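/- Setting. Let $\Omega\subset\mathbb R^2$ be a bounded polygonal domain lying on one side of its boundary, let $\emptyset\ne\Gamma_D\subset\partial\Omega$, and let $\mathbf D$ be a constant symmetric positive definite $3\times3$ matrix. Put $W=(L^2(\Omega))^3$, $V=\{\mathbf u\in (H^1(\Omega))^2:\mathbf u=\mathbf 0\text{ on }\Gamma_D\}$ (in the sense of traces), and, for $\mathbf v\in V$, $$\bm\epsilon[\mathbf v]=\mathbf B\mathbf v=(\partial_x v_x,\ \partial_y v_y,\ \partial_y v_x+\partial_x v_y)^T\in W,\qquad \bm\sigma[\mathbf v]=\mathbf D\mathbf B\mathbf v\in W .$$ For $\bm\epsilon,\bm\sigma\in W$ let $|||\bm\epsilon|||_Y^2=\int_\Omega \mathbf D\bm\epsilon:\bm\epsilon\,d\Omega$ and $|||\bm\sigma|||_{Y^*}^2=\int_\Omega\bm\sigma:\mathbf D^{-1}\bm\sigma\,d\Omega$, where $:$ is the Euclidean inner product of $\mathbb R^3$. Let $\mathcal T_h$ be a conforming subdivision of $\Omega$ either into triangles or into quadrilaterals. The center of an element is the mean of its nodes, and joining it to the nodes cuts the element into nonoverlapping subtriangles, one per edge.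 For triangles, $V_h\subset V$ consists of the continuous fields in $V$ that are affine on every element. For quadrilaterals, it consists of the continuous fields in $V$ that are affine on each of the four subtriangles of every element and whose value at the center of an element is the mean of the four nodal values. To each edge $e$ of $\mathcal T_h$ belongs a smoothing cell: the union of the subtriangles with base $e$ (for an interior edge, the quadrilateral whose vertices are the endpoints of $e$ and the centers of the two elements sharing $e$; for a boundary edge, a single subtriangle). Let $\mathcal T_{1,h}$ be the set of these cells, let $W_{1,h}\subset W$ be the space of fields that are constant on every cell, and let $P_{1,h}\colon W\to W_{1,h}$ be given by $(P_{1,h}\bm\epsilon)|_K=\frac1{|K|}\int_K\bm\epsilon\,d\Omega$ for $K\in\mathcal T_{1,h}$. Write $\hat{\bm\epsilon}[\mathbf v]=P_{1,h}(\mathbf B\mathbf v)$. On $\Pi=V\times W\times W$ put $|||(\mathbf u,\bm\epsilon_1,\bm\epsilon_2)|||_\Pi^2=|||\mathbf B\mathbf u|||_Y^2+|||\bm\epsilon_1|||_Y^2+|||\bm\epsilon_2|||_Y^2$ and $|(\mathbf u,\bm\epsilon_1,\bm\epsilon_2)|_\Pi=|||\bm\epsilon_2|||_Y$. For $(\mathbf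 v,\bm\delta_1,\bm\delta_2)\in\Pi$ and $(\bm\tau_1,\bm\tau_2)\in\Delta=W\times W$ let $$B\big((\mathbf v,\bm\delta_1,\bm\delta_2),(\bm\tau_1,\bm\tau_2)\big)=\int_\Omega\bm\tau_1:(\mathbf B\mathbf v-\bm\delta_1)\,d\Omega+\int_\Omega\bm\tau_2:(\bm\delta_1-\bm\delta_2)\,d\Omega .$$ Let $Z=\{U\in\Pi: B(U,Q)=0\ \forall Q\in\Delta\}$ and $$Z_h=\{U\in V_h\times W_{1,h}\times W_{1,h}: B(U,Q)=0\ \forall Q\in W_{1,h}\times W_{1,h}\}.$$ Call $\alpha>0$ a stability constant if $|U|_\Pi\ge\alpha\,|||U|||_\Pi$ for all $U\in Z\cup Z_h$. Claim. (i) There is a constant $C>0$ such that $|||\hat{\bm\epsilon}[\mathbf v]|||_Y\ge C\,|||\bm\epsilon[\mathbf v]|||_Y$ for all $\mathbf v\in V_h$. (ii) A stability constant $\alpha>0$ exists. (iii) Let $\alpha$ be any stability constant and $C_B=2/\alpha$. Let $f$ be a continuous linear functional on $V$, let $\mathbf u\in V$ satisfy $$\int_\Omega\mathbf D\bm\epsilon[\mathbf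 u]:\bm\epsilon[\mathbf v]\,d\Omega=f(\mathbf v)\quad\forall\mathbf v\in V,$$ and let $\hat{\mathbf u}_h\in V_h$ be a solution of the edge-based smoothed finite element method, that is, $$\int_\Omega\mathbf D\hat{\bm\epsilon}[\hat{\mathbf u}_h]:\hat{\bm\epsilon}[\mathbf v]\,d\Omega=f(\mathbf v)\quad\forall\mathbf v\in V_h .$$ Then $$|||\bm\epsilon[\mathbf u]-\hat{\bm\epsilon}[\hat{\mathbf u}_h]|||_Y\le 2\inf_{\mathbf v\in V_h}|||\bm\epsilon[\mathbf u]-\hat{\bm\epsilon}[\mathbf v]|||_Y+C_B\Big(\inf_{\bm\tau_1\in W_{1,h}}|||\bm\sigma[\mathbf u]-\bm\tau_1|||_{Y^*}+\inf_{\bm\tau_2\in W_{1,h}}|||\bm\sigma[\mathbf u]-\bm\tau_2|||_{Y^*}\Big).$$ -/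

import Mathlib

open MeasureTheory Set Filter Topology
open scoped ContDiff

noncomputable section

namespace ESFEM

/-! ### Function spaces of plane linear elasticity -/

/-- The plane `ℝ²`. -/
abbrev Plane := EuclideanSpace ℝ (Fin 2)

/-- `ℝ³`, the space of strains and stresses in Voigt notation
(`(ε_xx, ε_yy, 2 ε_xy)` and `(σ_xx, σ_yy, σ_xy)`). -/
abbrev Voigt := EuclideanSpace ℝ (Fin 3)

/-- The Hilbert space `L²(Ω; E)`. -/
abbrev L2 (Ω : Set Plane) (E : Type) [NormedAddCommGroup E] : Type :=
  Lp E 2 (volume.restrict Ω)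

/-- The space `W = (L²(Ω))³` of strain and stress fields. -/
abbrev W (Ω : Set Plane) : Type := L2 Ω Voigt

/-- A bounded polygonal domain in the plane, lying on one side of its boundary (no slits). -/
structure IsPolygonalDomain (Ω : Set Plane) : Prop where
  isOpen : IsOpen Ω
  isConnected : IsConnected Ω
  isBounded : Bornology.IsBounded Ω
  no_slit : interior (closure Ω) = Ω
  polygonal : ∃ S : Set (Plane × Plane), S.Finite ∧ frontier Ω ⊆ ⋃ s ∈ S, segment ℝ s.1 s.2

/-- `G 0` and `G 1` are the weak partial derivatives of `u` with respect to `x` and `y`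
in the open set `Ω`. -/
def IsWeakGradient (Ω : Set Plane) (u : L2 Ω Plane) (G : Fin 2 → L2 Ω Plane) : Prop :=
  ∀ φ : Plane → ℝ, ContDiff ℝ ∞ φ → HasCompactSupport φ → tsupport φ ⊆ Ω →
    ∀ i j : Fin 2,
      ∫ x in Ω, u x j * fderiv ℝ φ x (EuclideanSpace.single i 1) = - ∫ x in Ω, G i x j * φ x

/-- Vanishing of the trace on a part `Γ` of the boundary: at almost every point `x` of `Γ`
(for the arc length), the mean of `|u|` over `Ω ∩ B(x, r)` tends to `0` as `r → 0`. -/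
def HasZeroTraceOn (Ω Γ : Set Plane) (u : L2 Ω Plane) : Prop :=
  ∀ᵐ x ∂(Measure.hausdorffMeasure 1 : Measure Plane), x ∈ Γ →
    Tendsto (fun r : ℝ => ⨍ y in Metric.ball x r, ‖u y‖ ∂(volume.restrict Ω)) (𝓝[>] 0) (𝓝 0)

/-- The space in which `(H¹(Ω))²` lives: pairs `(u, (∂ₓ u, ∂ᵧ u))` of square integrable fields. Its
topology induces that of the `H¹`-norm. -/
abbrev Jet (Ω : Set Plane) : Type := L2 Ω Plane × (Fin 2 → L2 Ω Plane)

lemma integrable_coord_mul {Ω : Set Plane} (u : L2 Ω Plane) (j : Fin 2) {ψ : Plane → ℝ}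
    (hψ : Continuous ψ) (hc : HasCompactSupport ψ) :
    Integrable (fun x => u x j * ψ x) (volume.restrict Ω) := by
  have h1 : MemLp (fun x => u x j) 2 (volume.restrict Ω) :=
    ContinuousLinearMap.comp_memLp'
      (EuclideanSpace.proj j : EuclideanSpace ℝ (Fin 2) →L[ℝ] ℝ) (Lp.memLp u)
  have h2 : MemLp ψ 2 (volume.restrict Ω) := (hψ.memLp_of_hasCompactSupport hc)
  exact h1.integrable_mul h2

lemma continuous_fderiv_test {φ : Plane → ℝ} (h : ContDiff ℝ ∞ φ) (i : Fin 2) :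
    Continuous (fun x => fderiv ℝ φ x (EuclideanSpace.single i 1)) :=
  (h.continuous_fderiv (by simp)).clm_apply continuous_const

lemma hasCompactSupport_fderiv_test {φ : Plane → ℝ} (h : HasCompactSupport φ) (i : Fin 2) :
    HasCompactSupport (fun x => fderiv ℝ φ x (EuclideanSpace.single i 1)) :=
  h.fderiv_apply ℝ _

/-- `(H¹(Ω))²`, each function being stored together with its weak gradient (which it
determines). -/
def sobolevH1 (Ω : Set Plane) : Submodule ℝ (Jet Ω) where
  carrier := {p | IsWeakGradient Ω p.1 p.2}
  zero_mem' := by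
    intro φ _ _ _ i j
    have h0 : ∀ᵐ x ∂(volume.restrict Ω), (0 : L2 Ω Plane) x = 0 := Lp.coeFn_zero _ _ _
    have a1 : ∫ x in Ω, (0 : L2 Ω Plane) x j * fderiv ℝ φ x (EuclideanSpace.single i 1) = 0 := by
      apply integral_eq_zero_of_ae
      filter_upwards [h0] with x hx
      rw [hx]
      exact zero_mul _
    have a2 : ∫ x in Ω, (0 : L2 Ω Plane) x j * φ x = 0 := by
      apply integral_eq_zero_of_ae
      filter_upwards [h0] with x hx
      rw [hx]
      exact zero_mul _
    exact a1.trans (by rw [← neg_zero, ← a2]; rfl)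
  add_mem' := by
    intro p q hp hq φ h1 h2 h3 i j
    have ep := hp φ h1 h2 h3 i j
    have eq := hq φ h1 h2 h3 i j
    have c1 := continuous_fderiv_test h1 i
    have c2 := hasCompactSupport_fderiv_test h2 i
    have a1 : ∫ x in Ω, (p + q).1 x j * fderiv ℝ φ x (EuclideanSpace.single i 1)
        = (∫ x in Ω, p.1 x j * fderiv ℝ φ x (EuclideanSpace.single i 1))
          + ∫ x in Ω, q.1 x j * fderiv ℝ φ x (EuclideanSpace.single i 1) := by
      rw [← integral_add (integrable_coord_mul _ j c1 c2) (integrable_coord_mul _ j c1 c2)]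
      apply integral_congr_ae
      filter_upwards [Lp.coeFn_add p.1 q.1] with x hx
      rw [Prod.fst_add, hx]
      exact add_mul _ _ _
    have a2 : ∫ x in Ω, (p + q).2 i x j * φ x
        = (∫ x in Ω, p.2 i x j * φ x) + ∫ x in Ω, q.2 i x j * φ x := by
      rw [← integral_add (integrable_coord_mul _ j h1.continuous h2)
        (integrable_coord_mul _ j h1.continuous h2)]
      apply integral_congr_ae
      filter_upwards [Lp.coeFn_add (p.2 i) (q.2 i)] with x hx
      rw [Prod.snd_add, Pi.add_apply, hx]
      exact add_mul _ _ _
    rw [a1, a2, ep, eq]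
    ring
  smul_mem' := by
    intro c p hp φ h1 h2 h3 i j
    have ep := hp φ h1 h2 h3 i j
    have a1 : ∫ x in Ω, (c • p).1 x j * fderiv ℝ φ x (EuclideanSpace.single i 1)
        = c * ∫ x in Ω, p.1 x j * fderiv ℝ φ x (EuclideanSpace.single i 1) := by
      rw [← integral_const_mul]
      apply integral_congr_ae
      filter_upwards [Lp.coeFn_smul c p.1] with x hx
      simp [hx, mul_assoc]
    have a2 : ∫ x in Ω, (c • p).2 i x j * φ x = c * ∫ x in Ω, p.2 i x j * φ x := by
      rw [← integral_const_mul]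
      apply integral_congr_ae
      filter_upwards [Lp.coeFn_smul c (p.2 i)] with x hx
      simp [hx, mul_assoc]
    rw [a1, a2, ep]
    ring

lemma integrableOn_ball_norm {Ω : Set Plane} (u : L2 Ω Plane) (x : Plane) (r : ℝ) :
    Integrable (fun y => ‖u y‖) ((volume.restrict Ω).restrict (Metric.ball x r)) := by
  have : IsFiniteMeasure ((volume.restrict Ω).restrict (Metric.ball x r)) := by
    constructor
    rw [Measure.restrict_apply_univ]
    exact (Measure.restrict_apply_le _ _).trans_lt measure_ball_lt_top
  exact (((Lp.memLp u).restrict _).integrable (by norm_num)).norm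

lemma hasZeroTraceOn_zero (Ω Γ : Set Plane) : HasZeroTraceOn Ω Γ 0 := by
  refine Eventually.of_forall fun x _ => ?_
  have h : ∀ r : ℝ, ⨍ y in Metric.ball x r, ‖(0 : L2 Ω Plane) y‖ ∂(volume.restrict Ω) = 0 := by
    intro r
    rw [average_eq, integral_congr_ae (g := fun _ => (0 : ℝ))]
    · simp
    · have h0 : ∀ᵐ y ∂(volume.restrict Ω), (0 : L2 Ω Plane) y = 0 := Lp.coeFn_zero _ _ _
      filter_upwards [ae_restrict_of_ae h0] with y hy
      rw [hy, norm_zero]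
  exact tendsto_const_nhds.congr fun r => (h r).symm

lemma hasZeroTraceOn_add {Ω Γ : Set Plane} {u v : L2 Ω Plane} (hu : HasZeroTraceOn Ω Γ u)
    (hv : HasZeroTraceOn Ω Γ v) : HasZeroTraceOn Ω Γ (u + v) := by
  filter_upwards [hu, hv] with x hux hvx hx
  have hs := (hux hx).add (hvx hx)
  rw [add_zero] at hs
  refine squeeze_zero (fun r => ?_) (fun r => ?_) hs
  · rw [average_eq]
    exact smul_nonneg (by positivity) (integral_nonneg fun y => norm_nonneg _)
  · simp only [average_eq, smul_eq_mul, ← mul_add]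
    refine mul_le_mul_of_nonneg_left ?_ (by positivity)
    rw [← integral_add (integrableOn_ball_norm u x r) (integrableOn_ball_norm v x r)]
    refine integral_mono_ae (integrableOn_ball_norm _ x r)
      ((integrableOn_ball_norm u x r).add (integrableOn_ball_norm v x r)) ?_
    filter_upwards [ae_restrict_of_ae (Lp.coeFn_add u v)] with y hy
    rw [hy]
    exact norm_add_le _ _

lemma hasZeroTraceOn_smul {Ω Γ : Set Plane} {u : L2 Ω Plane} (c : ℝ)
    (hu : HasZeroTraceOn Ω Γ u) : HasZeroTraceOn Ω Γ (c • u) := by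
  filter_upwards [hu] with x hux hx
  have hs := (hux hx).const_mul ‖c‖
  rw [mul_zero] at hs
  refine hs.congr fun r => ?_
  simp only [average_eq, smul_eq_mul]
  rw [mul_left_comm, ← integral_const_mul]
  congr 1
  apply integral_congr_ae
  filter_upwards [ae_restrict_of_ae (Lp.coeFn_smul c u)] with y hy
  rw [hy]
  simp [norm_smul]

/-- The space `V = {u ∈ (H¹(Ω))² : u = 0 on Γ_D}` of kinematically admissible displacements. -/
def admissible (Ω ΓD : Set Plane) : Submodule ℝ (Jet Ω) where
  carrier := {p | p ∈ sobolevH1 Ω ∧ HasZeroTraceOn Ω ΓD p.1}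
  zero_mem' := ⟨(sobolevH1 Ω).zero_mem, hasZeroTraceOn_zero Ω ΓD⟩
  add_mem' := fun hp hq => ⟨(sobolevH1 Ω).add_mem hp.1 hq.1, hasZeroTraceOn_add hp.2 hq.2⟩
  smul_mem' := fun c _ hp => ⟨(sobolevH1 Ω).smul_mem c hp.1, hasZeroTraceOn_smul c hp.2⟩

/-- Pointwise action of a constant matrix on square integrable fields. -/
def matAct (Ω : Set Plane) {m n : ℕ} (A : Matrix (Fin m) (Fin n) ℝ) :
    L2 Ω (EuclideanSpace ℝ (Fin n)) →L[ℝ] L2 Ω (EuclideanSpace ℝ (Fin m)) :=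
  (LinearMap.toContinuousLinearMap (Matrix.toEuclideanLin A)).compLpL 2 (volume.restrict Ω)

/-- The strain `ε[u] = B u = (∂ₓ u_x, ∂ᵧ u_y, ∂ᵧ u_x + ∂ₓ u_y)`. -/
def strain {Ω : Set Plane} (p : Jet Ω) : W Ω :=
  matAct Ω !![1, 0; 0, 0; 0, 1] (p.2 0) + matAct Ω !![0, 0; 0, 1; 1, 0] (p.2 1)

/-- The energy norm of a strain field, `(∫_Ω D ε : ε)^{1/2}`. -/
def strainNorm {Ω : Set Plane} (D : Matrix (Fin 3) (Fin 3) ℝ) (ε : W Ω) : ℝ :=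
  √(inner ℝ (matAct Ω D ε) ε)

/-- The (dual) energy norm of a stress field, `(∫_Ω σ : D⁻¹ σ)^{1/2}`. -/
def stressNorm {Ω : Set Plane} (D : Matrix (Fin 3) (Fin 3) ℝ) (σ : W Ω) : ℝ :=
  √(inner ℝ σ (matAct Ω D⁻¹ σ))

/-! ### Meshes of triangles or quadrilaterals, and the edge-based smoothing cells -/

/-- The two finite elements: the 3-node triangle and the 4-node quadrilateral. -/
inductive ElementKind
  | tri
  | quad

/-- The number of nodes of an element. -/
def ElementKind.nodes : ElementKind → ℕ
  | .tri => 3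
  | .quad => 4

instance (k : ElementKind) : NeZero k.nodes := by cases k <;> exact ⟨by decide⟩

/-- Twice the signed area of the triangle `a b c`. -/
def orient (a b c : Plane) : ℝ :=
  (b 0 - a 0) * (c 1 - a 1) - (b 1 - a 1) * (c 0 - a 0)

/-- The center of an element with the given nodes: the centroid of a triangle, the image of
`r = s = 0` under the bilinear reference map of a quadrilateral. -/
def center {n : ℕ} (P : Fin n → Plane) : Plane := (1 / (n : ℝ)) • ∑ i, P i

/-- The subtriangle spanned by the center and the edge from node `i` to the (cyclically) next. -/
def subTri {n : ℕ} [NeZero n] (P : Fin n → Plane) (i : Fin n) : Set Plane :=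
  convexHull ℝ {center P, P i, P (i + 1)}

/-- The closed element with the given nodes, as the union of its subtriangles. -/
def region {n : ℕ} [NeZero n] (P : Fin n → Plane) : Set Plane := ⋃ i, subTri P i

/-- The edge from node `i` to the next one, as an unordered pair of nodes. -/
def edge {n : ℕ} [NeZero n] (P : Fin n → Plane) (i : Fin n) : Sym2 Plane := s(P i, P (i + 1))

/-- A conforming subdivision of `Ω` into triangles, or into quadrilaterals. Nodes are numbered
counterclockwise; a quadrilateral is cut by its center into four nonoverlapping triangles. -/
structure Mesh (k : ElementKind) (Ω : Set Plane) where
  /-- the number of elements -/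
  size : ℕ
  /-- the nodes of the elements -/
  node : Fin size → Fin k.nodes → Plane
  nondegenerate : ∀ t i, 0 < orient (center (node t)) (node t i) (node t (i + 1))
  cover : ⋃ t, region (node t) = closure Ω
  nonoverlapping : ∀ t t', t ≠ t' →
    Disjoint (interior (region (node t))) (interior (region (node t')))
  no_hanging_nodes : ∀ t t' i, node t' i ∈ region (node t) → node t' i ∈ range (node t)

/-- `w` agrees on `S` with a vector field of degree at most one. -/
def IsAffineOn (w : Plane → Plane) (S : Set Plane) : Prop :=
  ∃ A : Plane →ᵃ[ℝ] Plane, ∀ x ∈ S, w x = A x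

/-- The shape functions of an element: linear on a triangle; on a quadrilateral, linear on each of
the four subtriangles, with value at the center the mean of the four nodal values. -/
def IsShape : (k : ElementKind) → (Fin k.nodes → Plane) → (Plane → Plane) → Prop
  | .tri, P, w => IsAffineOn w (region P)
  | .quad, P, w => (∀ i, IsAffineOn w (subTri P i)) ∧
      w (center P) = (1 / 4 : ℝ) • ∑ i, w (P i)

lemma IsAffineOn.zero (S : Set Plane) : IsAffineOn 0 S := ⟨0, fun _ _ => rfl⟩

lemma IsAffineOn.add {w₁ w₂ : Plane → Plane} {S : Set Plane} (h₁ : IsAffineOn w₁ S)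
    (h₂ : IsAffineOn w₂ S) : IsAffineOn (w₁ + w₂) S := by
  obtain ⟨A, hA⟩ := h₁
  obtain ⟨A', hA'⟩ := h₂
  exact ⟨A + A', fun x hx => by simp [hA x hx, hA' x hx]⟩

lemma IsAffineOn.smul {w : Plane → Plane} {S : Set Plane} (c : ℝ) (h : IsAffineOn w S) :
    IsAffineOn (c • w) S := by
  obtain ⟨A, hA⟩ := h
  exact ⟨c • A, fun x hx => by simp [hA x hx]⟩

lemma IsShape.zero : ∀ (k : ElementKind) (P : Fin k.nodes → Plane), IsShape k P 0
  | .tri, _ => IsAffineOn.zero _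
  | .quad, _ => ⟨fun _ => IsAffineOn.zero _, by simp⟩

lemma IsShape.add : ∀ {k : ElementKind} {P : Fin k.nodes → Plane} {w₁ w₂ : Plane → Plane},
    IsShape k P w₁ → IsShape k P w₂ → IsShape k P (w₁ + w₂)
  | .tri, _, _, _, h₁, h₂ => IsAffineOn.add h₁ h₂
  | .quad, _, _, _, h₁, h₂ => ⟨fun i => (h₁.1 i).add (h₂.1 i), by
      simp only [Pi.add_apply, h₁.2, h₂.2, Finset.sum_add_distrib, smul_add]⟩

lemma IsShape.smul : ∀ {k : ElementKind} {P : Fin k.nodes → Plane} {w : Plane → Plane} (c : ℝ),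
    IsShape k P w → IsShape k P (c • w)
  | .tri, _, _, c, h => IsAffineOn.smul c h
  | .quad, _, _, c, h => ⟨fun i => (h.1 i).smul c, by
      simp only [Pi.smul_apply, h.2, ← Finset.smul_sum]
      rw [smul_comm]⟩

namespace Mesh

variable {k : ElementKind} {Ω : Set Plane}

/-- The discrete displacement space `V_h ⊆ V`: the continuous fields in `V` that are composed of
shape functions on the elements. -/
def Vh (M : Mesh k Ω) (ΓD : Set Plane) : Submodule ℝ (admissible Ω ΓD) where
  carrier := {u | ∃ w : Plane → Plane, ContinuousOn w (closure Ω) ∧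
    u.1.1 =ᵐ[volume.restrict Ω] w ∧ ∀ t, IsShape k (M.node t) w}
  zero_mem' := ⟨0, continuousOn_const, Lp.coeFn_zero _ _ _, fun _ => IsShape.zero _ _⟩
  add_mem' := by
    rintro u v ⟨w₁, c₁, e₁, s₁⟩ ⟨w₂, c₂, e₂, s₂⟩
    exact ⟨w₁ + w₂, c₁.add c₂, (Lp.coeFn_add u.1.1 v.1.1).trans (e₁.add e₂),
      fun t => (s₁ t).add (s₂ t)⟩
  smul_mem' := by
    rintro c u ⟨w, c₁, e₁, s₁⟩
    exact ⟨c • w, c₁.const_smul c, (Lp.coeFn_smul c u.1.1).trans (e₁.const_smul c),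
      fun t => (s₁ t).smul c⟩

open Classical in
/-- The set of edges of the mesh. -/
def edges (M : Mesh k Ω) : Finset (Sym2 Plane) :=
  Finset.univ.image fun p : Fin M.size × Fin k.nodes => edge (M.node p.1) p.2

/-- The smoothing cell of an edge `e`: the union of the subtriangles with base `e`. For an edge
shared by two elements it is the quadrilateral whose vertices are the endpoints of `e` and the
centers of the two elements; for a boundary edge it is a single subtriangle. The cells of the
edges form the subdivision `T_{1,h}`. -/
def cell (M : Mesh k Ω) (e : Sym2 Plane) : Set Plane :=
  ⋃ (t : Fin M.size) (i : Fin k.nodes) (_ : edge (M.node t) i = e), subTri (M.node t) i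

lemma isCompact_subTri {n : ℕ} [NeZero n] (P : Fin n → Plane) (i : Fin n) :
    IsCompact (subTri P i) :=
  (Set.toFinite ({center P, P i, P (i + 1)} : Set Plane)).isCompact_convexHull (𝕜 := ℝ)

lemma isCompact_cell (M : Mesh k Ω) (e : Sym2 Plane) : IsCompact (M.cell e) :=
  isCompact_iUnion fun _ => isCompact_iUnion fun _ => isCompact_iUnion fun _ =>
    isCompact_subTri _ _

lemma measurableSet_cell (M : Mesh k Ω) (e : Sym2 Plane) : MeasurableSet (M.cell e) :=
  (M.isCompact_cell e).measurableSet

lemma measure_cell_ne_top (M : Mesh k Ω) (e : Sym2 Plane) :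
    (volume.restrict Ω) (M.cell e) ≠ ⊤ :=
  ((Measure.restrict_apply_le _ _).trans_lt (M.isCompact_cell e).measure_lt_top).ne

/-- The space `W_{1,h} ⊆ W` of fields that are constant on every smoothing cell. -/
def W1h (M : Mesh k Ω) : Submodule ℝ (W Ω) where
  carrier := {ε | ∀ e ∈ M.edges, ∃ c : Voigt, ∀ᵐ x ∂(volume.restrict Ω), x ∈ M.cell e → ε x = c}
  zero_mem' := fun _ _ => ⟨0, by
    have h0 : ∀ᵐ x ∂(volume.restrict Ω), (0 : W Ω) x = 0 := Lp.coeFn_zero _ _ _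
    filter_upwards [h0] with x hx _
    exact hx⟩
  add_mem' := by
    intro ε δ hε hδ e he
    obtain ⟨c, hc⟩ := hε e he
    obtain ⟨d, hd⟩ := hδ e he
    refine ⟨c + d, ?_⟩
    filter_upwards [hc, hd, Lp.coeFn_add ε δ] with x h1 h2 h3 hx
    rw [h3, Pi.add_apply, h1 hx, h2 hx]
  smul_mem' := by
    intro a ε hε e he
    obtain ⟨c, hc⟩ := hε e he
    refine ⟨a • c, ?_⟩
    filter_upwards [hc, Lp.coeFn_smul a ε] with x h1 h2 hx
    rw [h2, Pi.smul_apply, h1 hx]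

/-- The piecewise smoothing operator `P_{1,h}`: on each smoothing cell, `P_{1,h} ε` is the mean
of `ε` over that cell. -/
def P1h (M : Mesh k Ω) (ε : W Ω) : W Ω :=
  ∑ e ∈ M.edges, indicatorConstLp 2 (M.measurableSet_cell e) (M.measure_cell_ne_top e)
    (⨍ x in M.cell e, ε x ∂(volume.restrict Ω))

/-- The smoothed strain `ε̂[v] = P_{1,h}(B v)`. -/
def smoothedStrain (M : Mesh k Ω) (p : Jet Ω) : W Ω := M.P1h (strain p)

end Mesh

/-! ### The mixed formulation and its stability constant -/

/-- `Π = V × W × W`. -/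
abbrev PiSpace (Ω ΓD : Set Plane) : Type := admissible Ω ΓD × W Ω × W Ω

/-- The bilinear form `B((v, δ₁, δ₂), (τ₁, τ₂)) = ⟨τ₁, B v - δ₁⟩ + ⟨τ₂, δ₁ - δ₂⟩` on `Π × Δ`, where
`Δ = W × W`. -/
def mixedForm {Ω ΓD : Set Plane} (U : PiSpace Ω ΓD) (Q : W Ω × W Ω) : ℝ :=
  inner ℝ Q.1 (strain (U.1 : Jet Ω) - U.2.1) + inner ℝ Q.2 (U.2.1 - U.2.2)

/-- The kernel `Z = {V ∈ Π : B(V, Q) = 0 for all Q ∈ Δ}`. -/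
def kernelZ (Ω ΓD : Set Plane) : Set (PiSpace Ω ΓD) :=
  {U | ∀ Q : W Ω × W Ω, mixedForm U Q = 0}

/-- The discrete kernel `Z_h = {V ∈ Π_h : B(V, Q) = 0 for all Q ∈ Δ_h}` of the edge-based smoothed
finite element method: `Π_h = V_h × W_{1,h} × W_{1,h}` and `Δ_h = W_{1,h} × W_{1,h}`. -/
def Mesh.kernelZh {k : ElementKind} {Ω : Set Plane} (M : Mesh k Ω) (ΓD : Set Plane) :
    Set (PiSpace Ω ΓD) :=
  {U | U.1 ∈ M.Vh ΓD ∧ U.2.1 ∈ M.W1h ∧ U.2.2 ∈ M.W1h ∧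
    ∀ Q : W Ω × W Ω, Q.1 ∈ M.W1h → Q.2 ∈ M.W1h → mixedForm U Q = 0}

/-- The norm on `Π`: `‖(u, ε₁, ε₂)‖² = ‖B u‖² + ‖ε₁‖² + ‖ε₂‖²` in the energy norm. -/
def piNorm {Ω ΓD : Set Plane} (D : Matrix (Fin 3) (Fin 3) ℝ) (U : PiSpace Ω ΓD) : ℝ :=
  √(strainNorm D (strain (U.1 : Jet Ω)) ^ 2 + strainNorm D U.2.1 ^ 2 + strainNorm D U.2.2 ^ 2)

/-- The seminorm on `Π`: `|(u, ε₁, ε₂)| = ‖ε₂‖` in the energy norm. -/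
def piSeminorm {Ω ΓD : Set Plane} (D : Matrix (Fin 3) (Fin 3) ℝ) (U : PiSpace Ω ΓD) : ℝ :=
  strainNorm D U.2.2

/-- `α` is a stability constant: `α > 0` and `|U| ≥ α ‖U‖` for all `U ∈ Z ∪ Z_h`. -/
def Mesh.IsStabilityConstant {k : ElementKind} {Ω : Set Plane} (M : Mesh k Ω) (ΓD : Set Plane)
    (D : Matrix (Fin 3) (Fin 3) ℝ) (α : ℝ) : Prop :=
  0 < α ∧ ∀ U ∈ kernelZ Ω ΓD ∪ M.kernelZh ΓD, α * piNorm D U ≤ piSeminorm D U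

/-- `u ∈ V` solves the weak problem `∫_Ω D ε[u] : ε[v] = f(v)` for all `v ∈ V`. -/
def IsWeakSolution {Ω ΓD : Set Plane} (D : Matrix (Fin 3) (Fin 3) ℝ)
    (f : admissible Ω ΓD →L[ℝ] ℝ) (u : admissible Ω ΓD) : Prop :=
  ∀ v : admissible Ω ΓD,
    inner ℝ (matAct Ω D (strain (u : Jet Ω))) (strain (v : Jet Ω)) = f v

/-- `û ∈ V_h` solves the edge-based smoothed problem `∫_Ω D ε̂[û] : ε̂[v] = f(v)` for all
`v ∈ V_h`. -/
def Mesh.IsESFEMSolution {k : ElementKind} {Ω ΓD : Set Plane} (M : Mesh k Ω)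
    (D : Matrix (Fin 3) (Fin 3) ℝ) (f : admissible Ω ΓD →L[ℝ] ℝ) (uh : admissible Ω ΓD) : Prop :=
  uh ∈ M.Vh ΓD ∧ ∀ v ∈ M.Vh ΓD,
    inner ℝ (matAct Ω D (M.smoothedStrain (uh : Jet Ω))) (M.smoothedStrain (v : Jet Ω)) = f v

end ESFEM

end

noncomputable section

namespace ESFEM

/-! ### Constant matrices acting on square integrable fields -/

/-! Factor `D = Bᵀ B` with `B` invertible. The energy norm of `ε` is then the `L²` norm of `B ε`,
the dual norm of `σ` is that of `B⁻ᵀ σ`, and their duality is Cauchy–Schwarz. `P1h` is the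
`L²`-orthogonal projection onto the cellwise constant fields (`inner_P1h`, `eq_P1h`); as constant
matrices preserve these fields, it is orthogonal for the energy product too.

(i) The strains of `V_h` form a finite-dimensional space, so it is enough that smoothing is
injective on it. Suppose all cell means vanish. The strain is constant on each subtriangle, and its
component along the base edge depends only on the displacements of the two endpoints, hence agrees
for all subtriangles of the cell. Its mean being zero, it vanishes: every edge keeps its length to
first order. For quadrilaterals these four conditions on eight nodal displacements still leave a
nonrigid mechanism, but the condition on the value at the center makes the whole element strain free
as soon as one subtriangle is (`quad_eq_rigid`). So a strained element is strained in all its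
subtriangles, and since the cell means vanish, each of its edges is shared with another strained
element. A finite family of elements cannot be closed in this way: look at its node farthest from
the origin (`eq_empty_of_forall_exists_adjacent`).

(ii) On `Z` both strain components equal `ε[u]`, on `Z_h` both equal `ε̂[u]`, so (i) is the
stability inequality.

(iii) For `v` in `V_h`, test both problems with `û_h - v`. The consistency error is `σ[u]` paired
with `(1 - P) ε[û_h - v]`; any cellwise constant `τ` can be subtracted from `σ[u]`, and stability
bounds the other factor by `1/α` times the smoothed error (`norm_smoothedStrain_sub_le`). The
triangle inequality then gives more than the claim: a single stress infimum with constant `1/α`. -/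

lemma coeFn_matAct (Ω : Set Plane) {m n : ℕ} (A : Matrix (Fin m) (Fin n) ℝ)
    (f : L2 Ω (EuclideanSpace ℝ (Fin n))) :
    matAct Ω A f =ᵐ[volume.restrict Ω] fun x => Matrix.toEuclideanLin A (f x) :=
  ContinuousLinearMap.coeFn_compLpL _ f

lemma matAct_matAct (Ω : Set Plane) {l m n : ℕ} (A : Matrix (Fin l) (Fin m) ℝ)
    (B : Matrix (Fin m) (Fin n) ℝ) (f : L2 Ω (EuclideanSpace ℝ (Fin n))) :
    matAct Ω A (matAct Ω B f) = matAct Ω (A * B) f := by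
  apply Lp.ext
  filter_upwards [coeFn_matAct Ω A (matAct Ω B f), coeFn_matAct Ω B f, coeFn_matAct Ω (A * B) f]
    with x h1 h2 h3
  rw [h1, h2, h3]
  simp [Matrix.toLpLin_apply, Matrix.mulVec_mulVec]

lemma matAct_one (Ω : Set Plane) {n : ℕ} (f : L2 Ω (EuclideanSpace ℝ (Fin n))) :
    matAct Ω (1 : Matrix (Fin n) (Fin n) ℝ) f = f := by
  apply Lp.ext
  filter_upwards [coeFn_matAct Ω (1 : Matrix (Fin n) (Fin n) ℝ) f] with x h1
  rw [h1]
  simp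

lemma inner_matAct_left (Ω : Set Plane) {m n : ℕ} (A : Matrix (Fin m) (Fin n) ℝ)
    (f : L2 Ω (EuclideanSpace ℝ (Fin n))) (g : L2 Ω (EuclideanSpace ℝ (Fin m))) :
    inner ℝ (matAct Ω A f) g = inner ℝ f (matAct Ω A.transpose g) := by
  rw [L2.inner_def, L2.inner_def]
  apply integral_congr_ae
  filter_upwards [coeFn_matAct Ω A f, coeFn_matAct Ω A.transpose g] with x h1 h2
  rw [h1, h2, ← Matrix.conjTranspose_eq_transpose_of_trivial,
    Matrix.toEuclideanLin_conjTranspose_eq_adjoint, LinearMap.adjoint_inner_right]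

-- `B` comes from positivity in the C⋆-algebra of matrices; it inherits invertibility from `D`
-- through the determinant.
open scoped MatrixOrder in
lemma exists_isUnit_det_transpose_mul_self {n : ℕ} {D : Matrix (Fin n) (Fin n) ℝ}
    (hD : D.PosDef) : ∃ B : Matrix (Fin n) (Fin n) ℝ, IsUnit B.det ∧ D = B.transpose * B := by
  obtain ⟨B, hB⟩ := CStarAlgebra.nonneg_iff_eq_star_mul_self.1
    (Matrix.nonneg_iff_posSemidef.2 hD.posSemidef)
  have hB' : D = B.transpose * B := by
    rw [hB, Matrix.star_eq_conjTranspose, Matrix.conjTranspose_eq_transpose_of_trivial]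
  refine ⟨B, ?_, hB'⟩
  have h := (Matrix.isUnit_iff_isUnit_det _).1 hD.isUnit
  rw [hB', Matrix.det_mul, IsUnit.mul_iff] at h
  exact h.2

/-! ### Energy norms and their duality through the factor `B` -/

section Factorization

variable {Ω : Set Plane} {B : Matrix (Fin 3) (Fin 3) ℝ}

lemma inner_matAct_transpose_mul_self (ε δ : W Ω) :
    inner ℝ (matAct Ω (B.transpose * B) ε) δ = inner ℝ (matAct Ω B ε) (matAct Ω B δ) := by
  rw [← matAct_matAct, inner_matAct_left, Matrix.transpose_transpose]

lemma strainNorm_transpose_mul_self (ε : W Ω) :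
    strainNorm (B.transpose * B) ε = ‖matAct Ω B ε‖ := by
  rw [strainNorm, inner_matAct_transpose_mul_self, real_inner_self_eq_norm_sq,
    Real.sqrt_sq (norm_nonneg _)]

lemma stressNorm_transpose_mul_self (σ : W Ω) :
    stressNorm (B.transpose * B) σ = ‖matAct Ω B⁻¹.transpose σ‖ := by
  have h : inner ℝ σ (matAct Ω (B.transpose * B)⁻¹ σ)
      = ‖matAct Ω B⁻¹.transpose σ‖ ^ 2 := by
    rw [← real_inner_self_eq_norm_sq, inner_matAct_left, matAct_matAct, Matrix.transpose_transpose,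
      Matrix.mul_inv_rev, Matrix.transpose_nonsing_inv]
  rw [stressNorm, h, Real.sqrt_sq (norm_nonneg _)]

lemma matAct_inv_matAct (hB : IsUnit B.det) (ε : W Ω) : matAct Ω B⁻¹ (matAct Ω B ε) = ε := by
  rw [matAct_matAct, Matrix.nonsing_inv_mul _ hB, matAct_one]

lemma inner_le_norm_mul_norm_of_isUnit_det (hB : IsUnit B.det) (σ ε : W Ω) :
    inner ℝ σ ε ≤ ‖matAct Ω B⁻¹.transpose σ‖ * ‖matAct Ω B ε‖ := by
  calc inner ℝ σ ε = inner ℝ σ (matAct Ω B⁻¹ (matAct Ω B ε)) := by rw [matAct_inv_matAct hB]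
    _ = inner ℝ (matAct Ω B⁻¹.transpose σ) (matAct Ω B ε) := by
        rw [inner_matAct_left, Matrix.transpose_transpose]
    _ ≤ _ := real_inner_le_norm _ _

end Factorization

/-- The strain operator as a linear map. -/
def strainLinear (Ω : Set Plane) : Jet Ω →ₗ[ℝ] W Ω where
  toFun := strain
  map_add' p q := by
    simp only [strain, Prod.snd_add, Pi.add_apply, map_add]
    abel
  map_smul' c p := by
    simp only [strain, Prod.smul_snd, Pi.smul_apply, map_smul, smul_add, RingHom.id_apply]

lemma strain_sub {Ω : Set Plane} (p q : Jet Ω) : strain (p - q) = strain p - strain q :=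
  (strainLinear Ω).map_sub p q

/-! ### Plane geometry of the subtriangles -/

lemma orient_self_left (a b : Plane) : orient a b a = 0 := by simp [orient]

lemma orient_self_right (a b : Plane) : orient a b b = 0 := by simp only [orient]; ring

lemma orient_swap (a b c : Plane) : orient a c b = -orient a b c := by simp only [orient]; ring

lemma orient_convexComb (a b x y : Plane) {s t : ℝ} (h : s + t = 1) :
    orient a b (s • x + t • y) = s * orient a b x + t * orient a b y := by
  obtain rfl : t = 1 - s := by linarith
  simp only [orient, PiLp.add_apply, PiLp.smul_apply, smul_eq_mul]
  ring

lemma continuous_orient {f g h : ℝ → Plane} (hf : Continuous f) (hg : Continuous g)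
    (hh : Continuous h) : Continuous fun s => orient (f s) (g s) (h s) := by
  unfold orient
  fun_prop

lemma convex_orient_nonneg (a b : Plane) : Convex ℝ {x | 0 ≤ orient a b x} := by
  intro x hx y hy s t hs ht hst
  have hx' : 0 ≤ orient a b x := hx
  have hy' : 0 ≤ orient a b y := hy
  show 0 ≤ orient a b _
  rw [orient_convexComb a b x y hst]
  positivity

lemma convex_orient_nonpos (a b : Plane) : Convex ℝ {x | orient a b x ≤ 0} := by
  intro x hx y hy s t hs ht hst
  have hx' : orient a b x ≤ 0 := hx
  have hy' : orient a b y ≤ 0 := hy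
  show orient a b _ ≤ 0
  rw [orient_convexComb a b x y hst]
  nlinarith

lemma volume_orient_eq_zero {a b : Plane} (hab : a ≠ b) :
    volume {x : Plane | orient a b x = 0} = 0 := by
  let S : AffineSubspace ℝ Plane :=
    { carrier := {x | orient a b x = 0}
      smul_vsub_vadd_mem' := by
        intro s x y z hx hy hz
        have hx' : orient a b x = 0 := hx
        have hy' : orient a b y = 0 := hy
        have hz' : orient a b z = 0 := hz
        show orient a b _ = 0
        have : orient a b (s • (x -ᵥ y) +ᵥ z)
            = s * (orient a b x - orient a b y) + orient a b z := by
          simp only [orient, vsub_eq_sub, vadd_eq_add, PiLp.add_apply, PiLp.smul_apply,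
            PiLp.sub_apply, smul_eq_mul]
          ring
        rw [this, hx', hy', hz']
        ring }
  refine Measure.addHaar_affineSubspace volume S fun hS => hab ?_
  -- The line is a proper subspace: the point `a` plus the quarter turn of `b - a` has `orient`
  -- equal to `|b - a|²`.
  have hmem : (!₂[a 0 - (b 1 - a 1), a 1 + (b 0 - a 0)] : Plane) ∈ S := by
    rw [hS]; exact AffineSubspace.mem_top ..
  have h : orient a b !₂[a 0 - (b 1 - a 1), a 1 + (b 0 - a 0)] = 0 := hmem
  simp only [orient, Matrix.cons_val_zero, Matrix.cons_val_one] at h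
  have h0 : b 0 - a 0 = 0 := by nlinarith [sq_nonneg (b 0 - a 0), sq_nonneg (b 1 - a 1)]
  have h1 : b 1 - a 1 = 0 := by nlinarith [sq_nonneg (b 0 - a 0), sq_nonneg (b 1 - a 1)]
  ext i
  fin_cases i
  · simp only [Fin.zero_eta]; linarith
  · simp only [Fin.mk_one]; linarith

/-- The line through `c` and `q` separates the two triangles, so they can meet only on it. -/
lemma volume_inter_convexHull_eq_zero {c q a₁ a₂ b₁ b₂ : Plane} (hcq : c ≠ q)
    (ha₁ : orient c q a₁ ≤ 0) (ha₂ : orient c q a₂ ≤ 0) (hb₁ : 0 ≤ orient c q b₁)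
    (hb₂ : 0 ≤ orient c q b₂) :
    volume (convexHull ℝ {c, a₁, a₂} ∩ convexHull ℝ {c, b₁, b₂}) = 0 := by
  refine measure_mono_null ?_ (volume_orient_eq_zero hcq)
  have ha : convexHull ℝ {c, a₁, a₂} ⊆ {x | orient c q x ≤ 0} := by
    refine convexHull_min ?_ (convex_orient_nonpos c q)
    rintro x (rfl | rfl | rfl)
    exacts [(orient_self_left _ _).le, ha₁, ha₂]
  have hb : convexHull ℝ {c, b₁, b₂} ⊆ {x | 0 ≤ orient c q x} := by
    refine convexHull_min ?_ (convex_orient_nonneg c q)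
    rintro x (rfl | rfl | rfl)
    exacts [(orient_self_left _ _).ge, hb₁, hb₂]
  exact fun x hx => le_antisymm (ha hx.1) (hb hx.2)

lemma ne_of_orient_pos_left {a b c : Plane} (h : 0 < orient a b c) : a ≠ b := by
  rintro rfl
  simp [orient] at h

lemma ne_of_orient_pos_right {a b c : Plane} (h : 0 < orient a b c) : b ≠ c := by
  rintro rfl
  rw [orient_self_right] at h
  exact lt_irrefl _ h

lemma mem_convexHull_of_orient_pos {a b c x : Plane} (h₁ : 0 < orient x b c)
    (h₂ : 0 < orient a x c) (h₃ : 0 < orient a b x) : x ∈ convexHull ℝ {a, b, c} := by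
  have hS : orient a b c = orient x b c + orient a x c + orient a b x := by
    simp only [orient]; ring
  have hpos : 0 < orient a b c := by rw [hS]; positivity
  -- The quotients of oriented areas are the barycentric coordinates of `x`.
  have hx : x = ∑ i : Fin 3, (![orient x b c / orient a b c, orient a x c / orient a b c,
      orient a b x / orient a b c] i) • (![a, b, c] i) := by
    ext i
    rw [Fin.sum_univ_three]
    simp only [Matrix.cons_val, PiLp.add_apply, PiLp.smul_apply, smul_eq_mul]
    field_simp
    fin_cases i <;> simp only [orient, Fin.zero_eta, Fin.mk_one] <;> ring
  rw [hx]
  refine (convex_convexHull ℝ _).sum_mem ?_ ?_ ?_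
  · intro i _
    fin_cases i
    exacts [(div_pos h₁ hpos).le, (div_pos h₂ hpos).le, (div_pos h₃ hpos).le]
  · rw [Fin.sum_univ_three]
    simp only [Matrix.cons_val_zero, Matrix.cons_val_one, Matrix.cons_val]
    rw [← add_div, ← add_div, ← hS, div_self hpos.ne']
  · intro i _
    apply subset_convexHull
    fin_cases i <;> simp

lemma mem_interior_convexHull_of_orient_pos {a b c x : Plane} (h₁ : 0 < orient x b c)
    (h₂ : 0 < orient a x c) (h₃ : 0 < orient a b x) :
    x ∈ interior (convexHull ℝ {a, b, c}) := by
  have h : IsOpen {y : Plane | 0 < orient y b c ∧ 0 < orient a y c ∧ 0 < orient a b y} := by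
    have open_pos : ∀ {f : Plane → ℝ}, Continuous f → IsOpen {y | 0 < f y} :=
      fun hf => isOpen_lt continuous_const hf
    refine (open_pos ?_).inter ((open_pos ?_).inter (open_pos ?_)) <;>
    · unfold orient
      fun_prop
  exact interior_maximal (fun y hy => mem_convexHull_of_orient_pos hy.1 hy.2.1 hy.2.2) h
    ⟨h₁, h₂, h₃⟩

/-- Both triangles lie on the same side of their common base. A point slightly off the midpoint of
the base, moved towards the apexes, is interior to both: its area coordinate at the base grows
linearly in `s`, and the other two are close to half of the full area. -/
lemma exists_mem_interior_inter {c c' p q : Plane} (h : 0 < orient c p q)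
    (h' : 0 < orient c' p q) :
    ∃ x, x ∈ interior (convexHull ℝ {c, p, q}) ∧ x ∈ interior (convexHull ℝ {c', p, q}) := by
  let m : Plane := (1 / 2 : ℝ) • (p + q)
  let x : ℝ → Plane := fun s => m + s • (c + c' - (2 : ℝ) • m)
  have hx : Continuous x := by fun_prop
  have near : ∀ {f : ℝ → ℝ}, Continuous f → 0 < f 0 → ∀ᶠ s in 𝓝[>] (0 : ℝ), 0 < f s :=
    fun hf h0 => (hf.tendsto 0).eventually_const_lt h0 |>.filter_mono nhdsWithin_le_nhds
  have e0 : ∀ s, orient (x s) p q = s * (orient c p q + orient c' p q) := by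
    intro s
    simp only [orient, x, m, PiLp.add_apply, PiLp.smul_apply, PiLp.sub_apply, smul_eq_mul]
    ring
  have e1 : ∀ d : Plane, orient d (x 0) q = orient d p q / 2 := by
    intro d
    simp only [orient, x, m, PiLp.add_apply, PiLp.smul_apply, PiLp.sub_apply, smul_eq_mul]
    ring
  have e2 : ∀ d : Plane, orient d p (x 0) = orient d p q / 2 := by
    intro d
    simp only [orient, x, m, PiLp.add_apply, PiLp.smul_apply, PiLp.sub_apply, smul_eq_mul]
    ring
  have n1 : ∀ d : Plane, 0 < orient d p q → ∀ᶠ s in 𝓝[>] (0 : ℝ), 0 < orient d (x s) q :=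
    fun d hd => near (f := fun s => orient d (x s) q)
      (continuous_orient continuous_const hx continuous_const) (by simp only [e1]; positivity)
  have n2 : ∀ d : Plane, 0 < orient d p q → ∀ᶠ s in 𝓝[>] (0 : ℝ), 0 < orient d p (x s) :=
    fun d hd => near (f := fun s => orient d p (x s))
      (continuous_orient continuous_const continuous_const hx) (by simp only [e2]; positivity)
  obtain ⟨s, hs, h1, h2, h3, h4⟩ := (eventually_mem_nhdsWithin.and
    ((n1 c h).and ((n2 c h).and ((n1 c' h').and (n2 c' h'))))).exists
  have hs' : 0 < s := hs
  have h0 : 0 < orient (x s) p q := by rw [e0]; positivity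
  exact ⟨x s, mem_interior_convexHull_of_orient_pos h0 h1 h2,
    mem_interior_convexHull_of_orient_pos h0 h3 h4⟩

/-! ### The subtriangles of an element -/

lemma center_mem_subTri {n : ℕ} [NeZero n] (P : Fin n → Plane) (i : Fin n) :
    center P ∈ subTri P i := subset_convexHull ℝ _ (by simp)

lemma node_mem_subTri {n : ℕ} [NeZero n] (P : Fin n → Plane) (i : Fin n) : P i ∈ subTri P i :=
  subset_convexHull ℝ _ (by simp)

lemma next_mem_subTri {n : ℕ} [NeZero n] (P : Fin n → Plane) (i : Fin n) :
    P (i + 1) ∈ subTri P i := subset_convexHull ℝ _ (by simp)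

lemma subTri_subset_region {n : ℕ} [NeZero n] (P : Fin n → Plane) (i : Fin n) :
    subTri P i ⊆ region P := subset_iUnion (subTri P) i

/-- The separating line passes through the center and the common node. -/
lemma volume_subTri_inter_next {n : ℕ} [NeZero n] {P : Fin n → Plane}
    (h : ∀ i, 0 < orient (center P) (P i) (P (i + 1))) (i : Fin n) :
    volume (subTri P i ∩ subTri P (i + 1)) = 0 := by
  refine volume_inter_convexHull_eq_zero (q := P (i + 1)) (ne_of_orient_pos_left (h (i + 1)))
    ?_ (orient_self_right _ _).le (orient_self_right _ _).ge (h (i + 1)).le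
  rw [orient_swap]
  linarith [h i]

lemma tri_index_cases : ∀ i j : Fin ElementKind.tri.nodes, i ≠ j → j = i + 1 ∨ i = j + 1 := by
  decide

lemma quad_index_cases : ∀ i j : Fin ElementKind.quad.nodes,
    i ≠ j → j = i + 1 ∨ i = j + 1 ∨ j = i + 1 + 1 := by
  decide

lemma quad_index_add_four : ∀ i : Fin ElementKind.quad.nodes, i + 1 + 1 + 1 + 1 = i := by
  decide

lemma quad_sum {E : Type*} [AddCommMonoid E] (f : Fin ElementKind.quad.nodes → E)
    (i : Fin ElementKind.quad.nodes) :
    ∑ l, f l = f i + f (i + 1) + f (i + 1 + 1) + f (i + 1 + 1 + 1) := by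
  have h : (Finset.univ : Finset (Fin ElementKind.quad.nodes))
      = {i, i + 1, i + 1 + 1, i + 1 + 1 + 1} := by
    revert i; decide
  rw [h, Finset.sum_insert, Finset.sum_insert, Finset.sum_insert, Finset.sum_singleton,
    ← add_assoc, ← add_assoc] <;>
  · clear h f; revert i; decide

lemma quad_center_eq (P : Fin ElementKind.quad.nodes → Plane) (i : Fin ElementKind.quad.nodes)
    (l : Fin 2) :
    4 * center P l = P i l + P (i + 1) l + P (i + 1 + 1) l + P (i + 1 + 1 + 1) l := by
  rw [center, quad_sum P i]
  simp only [PiLp.add_apply, PiLp.smul_apply, smul_eq_mul, ElementKind.nodes]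
  push_cast
  ring

lemma volume_subTri_inter_opposite {P : Fin ElementKind.quad.nodes → Plane}
    (h : ∀ i, 0 < orient (center P) (P i) (P (i + 1))) (i : Fin ElementKind.quad.nodes) :
    volume (subTri P i ∩ subTri P (i + 1 + 1)) = 0 := by
  have h0 := h i
  have h1 := h (i + 1)
  have h2 := h (i + 1 + 1)
  have h3 := h (i + 1 + 1 + 1)
  rw [quad_index_add_four] at h3
  -- Opposite subtriangles share only the center. Depending on which side of the ray to `P i` the
  -- node `P (i + 1 + 1)` lies, the separating line passes through `P i` or through `P (i + 1 + 1)`.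
  rcases le_total (orient (center P) (P i) (P (i + 1 + 1))) 0 with hs | hs
  · rw [inter_comm]
    refine volume_inter_convexHull_eq_zero (q := P i) (ne_of_orient_pos_left h0) hs ?_
      (orient_self_right _ _).ge h0.le
    rw [orient_swap]
    linarith
  · refine volume_inter_convexHull_eq_zero (q := P (i + 1 + 1)) (ne_of_orient_pos_left h2) ?_ ?_
      (orient_self_right _ _).ge h2.le
    · rw [orient_swap]
      linarith
    · rw [orient_swap]
      linarith

lemma volume_subTri_inter_eq_zero : ∀ {k : ElementKind} {P : Fin k.nodes → Plane},
    (∀ i, 0 < orient (center P) (P i) (P (i + 1))) → ∀ {i j : Fin k.nodes}, i ≠ j →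
    volume (subTri P i ∩ subTri P j) = 0
  | .tri, P, h, i, j, hij => by
    rcases tri_index_cases i j hij with rfl | rfl
    · exact volume_subTri_inter_next h _
    · rw [inter_comm]; exact volume_subTri_inter_next h _
  | .quad, P, h, i, j, hij => by
    rcases quad_index_cases i j hij with rfl | rfl | rfl
    · exact volume_subTri_inter_next h _
    · rw [inter_comm]; exact volume_subTri_inter_next h _
    · exact volume_subTri_inter_opposite h _

/-! ### The subtriangles of a mesh: null overlaps and covering -/

namespace Mesh

variable {k : ElementKind} {Ω : Set Plane}

/-- The subtriangles of a mesh, indexed by element and local edge number. -/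
def piece (M : Mesh k Ω) (p : Fin M.size × Fin k.nodes) : Set Plane := subTri (M.node p.1) p.2

/-- The edge at the base of a subtriangle. -/
def base (M : Mesh k Ω) (p : Fin M.size × Fin k.nodes) : Sym2 Plane := edge (M.node p.1) p.2

lemma isCompact_piece (M : Mesh k Ω) (p : Fin M.size × Fin k.nodes) : IsCompact (M.piece p) :=
  isCompact_subTri _ _

lemma measurableSet_piece (M : Mesh k Ω) (p : Fin M.size × Fin k.nodes) :
    MeasurableSet (M.piece p) := (M.isCompact_piece p).measurableSet

lemma base_mem_edges (M : Mesh k Ω) (p : Fin M.size × Fin k.nodes) : M.base p ∈ M.edges := by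
  classical
  exact Finset.mem_image_of_mem _ (Finset.mem_univ p)

lemma volume_frontier_piece (M : Mesh k Ω) (p : Fin M.size × Fin k.nodes) :
    volume (frontier (M.piece p)) = 0 :=
  (convex_convexHull ℝ _).addHaar_frontier volume

lemma piece_subset_closure (M : Mesh k Ω) (p : Fin M.size × Fin k.nodes) :
    M.piece p ⊆ closure Ω := by
  rw [← M.cover]
  exact (subTri_subset_region _ _).trans (subset_iUnion (fun t => region (M.node t)) p.1)

lemma interior_piece_subset (M : Mesh k Ω) (hΩ : IsPolygonalDomain Ω)
    (p : Fin M.size × Fin k.nodes) : interior (M.piece p) ⊆ Ω := by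
  exact (interior_mono (M.piece_subset_closure p)).trans hΩ.no_slit.subset

lemma interior_piece_nonempty (M : Mesh k Ω) (p : Fin M.size × Fin k.nodes) :
    (interior (M.piece p)).Nonempty := by
  obtain ⟨x, hx, _⟩ := exists_mem_interior_inter (M.nondegenerate p.1 p.2) (M.nondegenerate p.1 p.2)
  exact ⟨x, hx⟩

lemma volume_piece_inter (M : Mesh k Ω) {p q : Fin M.size × Fin k.nodes} (hpq : p ≠ q) :
    volume (M.piece p ∩ M.piece q) = 0 := by
  by_cases h1 : p.1 = q.1
  · obtain ⟨t, i⟩ := p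
    obtain ⟨t', j⟩ := q
    obtain rfl : t = t' := h1
    exact volume_subTri_inter_eq_zero (M.nondegenerate t) fun h : i = j => hpq (by rw [h])
  -- Different elements have disjoint interiors, so their subtriangles meet inside the two
  -- frontiers, which are null by convexity.
  · refine measure_mono_null (t := frontier (M.piece p) ∪ frontier (M.piece q)) ?_
      (measure_union_null (M.volume_frontier_piece p) (M.volume_frontier_piece q))
    rintro x ⟨hp, hq⟩
    by_contra hx
    rw [mem_union, not_or] at hx
    have hp' : x ∈ interior (M.piece p) := by
      by_contra h; exact hx.1 ⟨subset_closure hp, h⟩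
    have hq' : x ∈ interior (M.piece q) := by
      by_contra h; exact hx.2 ⟨subset_closure hq, h⟩
    exact (M.nonoverlapping _ _ h1).le_bot
      ⟨interior_mono (subTri_subset_region _ _) hp', interior_mono (subTri_subset_region _ _) hq'⟩

/-- Two subtriangles on the same side of the same base overlap in an open set. Consequently an edge
common to two distinct subtriangles is traversed by them in opposite directions. -/
lemma eq_of_node_eq (M : Mesh k Ω) {p q : Fin M.size × Fin k.nodes}
    (h : M.node p.1 p.2 = M.node q.1 q.2)
    (h' : M.node p.1 (p.2 + 1) = M.node q.1 (q.2 + 1)) : p = q := by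
  by_contra hpq
  have h₁ := M.nondegenerate p.1 p.2
  rw [h, h'] at h₁
  obtain ⟨x, hx, hx'⟩ := exists_mem_interior_inter h₁ (M.nondegenerate q.1 q.2)
  rw [← h, ← h'] at hx
  have hpos : 0 < volume (interior (M.piece p) ∩ interior (M.piece q)) :=
    (isOpen_interior.inter isOpen_interior).measure_pos _ ⟨x, hx, hx'⟩
  exact hpos.ne' (measure_mono_null (inter_subset_inter interior_subset interior_subset)
    (M.volume_piece_inter hpq))

lemma measure_piece_pos (M : Mesh k Ω) (hΩ : IsPolygonalDomain Ω)
    (p : Fin M.size × Fin k.nodes) : 0 < (volume.restrict Ω) (M.piece p) := by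
  refine lt_of_lt_of_le
    (isOpen_interior.measure_pos volume (M.interior_piece_nonempty p)) ?_
  rw [← Measure.restrict_eq_self volume (M.interior_piece_subset hΩ p)]
  exact measure_mono interior_subset

lemma measure_piece_ne_top (M : Mesh k Ω) (p : Fin M.size × Fin k.nodes) :
    (volume.restrict Ω) (M.piece p) ≠ ⊤ :=
  ((Measure.restrict_apply_le _ _).trans_lt (M.isCompact_piece p).measure_lt_top).ne

lemma aedisjoint_piece (M : Mesh k Ω) :
    Pairwise (Function.onFun (AEDisjoint (volume.restrict Ω)) M.piece) := fun _ _ hpq =>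
  le_antisymm ((Measure.restrict_apply_le _ _).trans (M.volume_piece_inter hpq).le) zero_le

lemma cell_eq_iUnion (M : Mesh k Ω) (e : Sym2 Plane) :
    M.cell e = ⋃ p : {p // M.base p = e}, M.piece p := by
  ext x
  simp only [cell, mem_iUnion, Subtype.exists, Prod.exists, piece, base, exists_prop]

lemma piece_subset_cell (M : Mesh k Ω) (p : Fin M.size × Fin k.nodes) :
    M.piece p ⊆ M.cell (M.base p) := by
  rw [cell_eq_iUnion]
  exact subset_iUnion (fun q : {q // M.base q = M.base p} => M.piece q) ⟨p, rfl⟩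

lemma exists_mem_piece (M : Mesh k Ω) {x : Plane} (hx : x ∈ closure Ω) : ∃ p, x ∈ M.piece p := by
  rw [← M.cover] at hx
  obtain ⟨t, ht⟩ := mem_iUnion.1 hx
  obtain ⟨i, hi⟩ := mem_iUnion.1 ht
  exact ⟨(t, i), hi⟩

lemma ae_exists_mem_piece (M : Mesh k Ω) (hΩ : IsPolygonalDomain Ω) :
    ∀ᵐ x ∂(volume.restrict Ω), ∃ p, x ∈ M.piece p := by
  filter_upwards [ae_restrict_mem hΩ.isOpen.measurableSet] with x hx
  exact M.exists_mem_piece (subset_closure hx)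

lemma ae_eq_of_mem_piece (M : Mesh k Ω) :
    ∀ᵐ x ∂(volume.restrict Ω), ∀ p q, x ∈ M.piece p → x ∈ M.piece q → p = q := by
  rw [ae_all_iff]
  intro p
  rw [ae_all_iff]
  intro q
  by_cases hpq : p = q
  · exact Eventually.of_forall fun _ _ _ => hpq
  · have h : ∀ᵐ x ∂(volume.restrict Ω), x ∉ M.piece p ∩ M.piece q :=
      measure_eq_zero_iff_ae_notMem.1 (M.aedisjoint_piece hpq)
    filter_upwards [h] with x hx hp hq
    exact absurd ⟨hp, hq⟩ hx

end Mesh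

/-! ### The smoothing operator is the orthogonal projection onto the cellwise constant fields -/

namespace Mesh

variable {k : ElementKind} {Ω : Set Plane}

lemma ae_eq_of_mem_cell (M : Mesh k Ω) :
    ∀ᵐ x ∂(volume.restrict Ω), ∀ e e', x ∈ M.cell e → x ∈ M.cell e' → e = e' := by
  filter_upwards [M.ae_eq_of_mem_piece] with x hx e e' he he'
  rw [cell_eq_iUnion, mem_iUnion] at he he'
  obtain ⟨⟨p, rfl⟩, hp⟩ := he
  obtain ⟨⟨q, rfl⟩, hq⟩ := he'
  rw [hx p q hp hq]

lemma ae_exists_mem_cell (M : Mesh k Ω) (hΩ : IsPolygonalDomain Ω) :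
    ∀ᵐ x ∂(volume.restrict Ω), ∃ e ∈ M.edges, x ∈ M.cell e := by
  filter_upwards [M.ae_exists_mem_piece hΩ] with x ⟨p, hp⟩
  exact ⟨M.base p, M.base_mem_edges p, M.piece_subset_cell p hp⟩

/-- The field with constant value `c e` on the cell of each edge `e`. -/
def cellwise (M : Mesh k Ω) (c : Sym2 Plane → Voigt) : W Ω :=
  ∑ e ∈ M.edges, indicatorConstLp 2 (M.measurableSet_cell e) (M.measure_cell_ne_top e) (c e)

lemma coeFn_cellwise (M : Mesh k Ω) (c : Sym2 Plane → Voigt) :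
    ∀ᵐ x ∂(volume.restrict Ω), ∀ e ∈ M.edges, x ∈ M.cell e → M.cellwise c x = c e := by
  have h1 : ∀ᵐ x ∂(volume.restrict Ω), ∀ e ∈ M.edges,
      indicatorConstLp 2 (M.measurableSet_cell e) (M.measure_cell_ne_top e) (c e) x
        = (M.cell e).indicator (fun _ => c e) x :=
    (Finset.eventually_all _).2 fun e _ => indicatorConstLp_coeFn
  have h2 : M.cellwise c =ᵐ[volume.restrict Ω] ∑ e ∈ M.edges,
      ⇑(indicatorConstLp 2 (M.measurableSet_cell e) (M.measure_cell_ne_top e) (c e)) :=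
    Lp.coeFn_finsetSum _ _
  filter_upwards [h1, h2, M.ae_eq_of_mem_cell] with x h1 h2 h3 e he hx
  rw [h2, Finset.sum_apply, Finset.sum_congr rfl h1, Finset.sum_eq_single e]
  · rw [indicator_of_mem hx]
  · intro e' _ hne
    exact indicator_of_notMem (fun hx' => hne (h3 _ _ hx' hx)) _
  · exact fun h => absurd he h

lemma cellwise_mem_W1h (M : Mesh k Ω) (c : Sym2 Plane → Voigt) : M.cellwise c ∈ M.W1h :=
  fun e he => ⟨c e, (M.coeFn_cellwise c).mono fun _ hx => hx e he⟩

lemma exists_eq_cellwise (M : Mesh k Ω) (hΩ : IsPolygonalDomain Ω) {τ : W Ω} (hτ : τ ∈ M.W1h) :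
    ∃ c, τ = M.cellwise c := by
  choose! c hc using hτ
  refine ⟨c, Lp.ext ?_⟩
  filter_upwards [(Finset.eventually_all _).2 hc, M.coeFn_cellwise c, M.ae_exists_mem_cell hΩ]
    with x h1 h2 ⟨e, he, hx⟩
  rw [h1 e he hx, h2 e he hx]

lemma P1h_mem_W1h (M : Mesh k Ω) (ε : W Ω) : M.P1h ε ∈ M.W1h := M.cellwise_mem_W1h _

lemma setIntegral_cell_P1h (M : Mesh k Ω) (ε : W Ω) {e : Sym2 Plane} (he : e ∈ M.edges) :
    ∫ x in M.cell e, M.P1h ε x ∂(volume.restrict Ω) = ∫ x in M.cell e, ε x ∂(volume.restrict Ω) := by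
  rw [← measure_smul_setAverage ε (M.measure_cell_ne_top e), ← setIntegral_const]
  refine setIntegral_congr_ae (M.measurableSet_cell e) ?_
  filter_upwards [M.coeFn_cellwise
    (fun e => ⨍ x in M.cell e, ε x ∂(volume.restrict Ω))] with x hx
  exact hx e he

lemma inner_cellwise (M : Mesh k Ω) (c : Sym2 Plane → Voigt) (ε : W Ω) :
    inner ℝ (M.cellwise c) ε
      = ∑ e ∈ M.edges, inner ℝ (c e) (∫ x in M.cell e, ε x ∂(volume.restrict Ω)) := by
  rw [cellwise, sum_inner]
  exact Finset.sum_congr rfl fun e _ => L2.inner_indicatorConstLp_eq_inner_setIntegral ..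

lemma inner_P1h (M : Mesh k Ω) (hΩ : IsPolygonalDomain Ω) {τ : W Ω} (hτ : τ ∈ M.W1h) (ε : W Ω) :
    inner ℝ τ (M.P1h ε) = inner ℝ τ ε := by
  obtain ⟨c, rfl⟩ := M.exists_eq_cellwise hΩ hτ
  rw [inner_cellwise, inner_cellwise]
  exact Finset.sum_congr rfl fun e he => by rw [M.setIntegral_cell_P1h ε he]

/-- Uniqueness of the orthogonal projection. Linearity of `P1h` and the description of `Z_h` both
follow from it. -/
lemma eq_P1h (M : Mesh k Ω) (hΩ : IsPolygonalDomain Ω) {ε δ : W Ω} (hδ : δ ∈ M.W1h)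
    (h : ∀ τ ∈ M.W1h, inner ℝ τ δ = inner ℝ τ ε) : δ = M.P1h ε := by
  have hmem := M.W1h.sub_mem hδ (M.P1h_mem_W1h ε)
  rw [← sub_eq_zero, ← inner_self_eq_zero (𝕜 := ℝ), inner_sub_right, h _ hmem,
    M.inner_P1h hΩ hmem, sub_self]

/-- The smoothing operator as a linear map. -/
def P1hLinear (M : Mesh k Ω) (hΩ : IsPolygonalDomain Ω) : W Ω →ₗ[ℝ] W Ω where
  toFun := M.P1h
  map_add' ε δ := by
    refine (M.eq_P1h hΩ (M.W1h.add_mem (M.P1h_mem_W1h ε) (M.P1h_mem_W1h δ)) fun τ hτ => ?_).symm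
    rw [inner_add_right, inner_add_right, M.inner_P1h hΩ hτ, M.inner_P1h hΩ hτ]
  map_smul' c ε := by
    refine (M.eq_P1h hΩ (M.W1h.smul_mem c (M.P1h_mem_W1h ε)) fun τ hτ => ?_).symm
    simp only [inner_smul_right, M.inner_P1h hΩ hτ]

lemma smoothedStrain_sub (M : Mesh k Ω) (hΩ : IsPolygonalDomain Ω) (p q : Jet Ω) :
    M.smoothedStrain (p - q) = M.smoothedStrain p - M.smoothedStrain q := by
  rw [smoothedStrain, strain_sub]
  exact (M.P1hLinear hΩ).map_sub _ _

/-- This invariance makes the `L²` projection orthogonal in the energy product as well. -/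
lemma matAct_mem_W1h (M : Mesh k Ω) (A : Matrix (Fin 3) (Fin 3) ℝ) {τ : W Ω} (hτ : τ ∈ M.W1h) :
    matAct Ω A τ ∈ M.W1h := by
  intro e he
  obtain ⟨c, hc⟩ := hτ e he
  refine ⟨Matrix.toEuclideanLin A c, ?_⟩
  filter_upwards [hc, coeFn_matAct Ω A τ] with x h1 h2 hx
  rw [h2, h1 hx]

lemma setIntegral_cell (M : Mesh k Ω) (ε : W Ω) (e : Sym2 Plane) :
    ∫ x in M.cell e, ε x ∂(volume.restrict Ω)
      = ∑ p : {p // M.base p = e}, ∫ x in M.piece p, ε x ∂(volume.restrict Ω) := by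
  classical
  rw [cell_eq_iUnion, integral_iUnion_ae, tsum_fintype]
  · exact fun p => (M.measurableSet_piece p).nullMeasurableSet
  · exact fun p q hpq => M.aedisjoint_piece fun h => hpq (Subtype.ext h)
  · rw [← cell_eq_iUnion]
    exact integrableOn_Lp_of_measure_ne_top ε fact_one_le_two_ennreal.elim (M.measure_cell_ne_top e)

end Mesh

/-! ### Weak gradients of piecewise affine fields -/

lemma integral_affine_mul_fderiv (A : Plane →ᵃ[ℝ] Plane) {φ : Plane → ℝ} (h : ContDiff ℝ ∞ φ)
    (hc : HasCompactSupport φ) (i j : Fin 2) :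
    ∫ x, A x j * fderiv ℝ φ x (EuclideanSpace.single i 1)
      = -∫ x, A.linear (EuclideanSpace.single i 1) j * φ x := by
  let L : Plane →L[ℝ] Plane := LinearMap.toContinuousLinearMap A.linear
  have hA : ∀ x, A x = L x + A 0 := fun x => congrFun A.decomp x
  have hd : ∀ x, HasFDerivAt (fun x => A x j) ((EuclideanSpace.proj j).comp L) x := by
    intro x
    have h1 : HasFDerivAt (fun x => L x + A 0) L x := L.hasFDerivAt.add_const _
    simp only [← hA] at h1
    exact (EuclideanSpace.proj (𝕜 := ℝ) j).hasFDerivAt.comp x h1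
  have hAc : Continuous fun x => A x j :=
    continuous_iff_continuousAt.2 fun x => (hd x).continuousAt
  have key := integral_mul_fderiv_eq_neg_fderiv_mul_of_integrable (μ := volume)
    (f := fun x => A x j) (g := φ) (v := EuclideanSpace.single i 1) ?_ ?_ ?_
    (fun x _ => (hd x).differentiableAt)
    (fun x _ => (h.differentiable (by simp)).differentiableAt)
  · rw [key]
    congr 1
    refine integral_congr_ae (Eventually.of_forall fun x => ?_)
    simp only [(hd x).fderiv]
    rfl
  · simp only [(hd _).fderiv]
    exact (continuous_const.mul h.continuous).integrable_of_hasCompactSupport hc.mul_left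
  · exact (hAc.mul (continuous_fderiv_test h i)).integrable_of_hasCompactSupport
      (hasCompactSupport_fderiv_test hc i).mul_left
  · exact (hAc.mul h.continuous).integrable_of_hasCompactSupport hc.mul_left

/-- Test functions supported in `U` see only the affine field, for which integration by parts is
classical; the fundamental lemma of the calculus of variations then identifies `G i` on `U`. -/
lemma IsWeakGradient.ae_eq_of_affine {Ω U : Set Plane} {u : L2 Ω Plane}
    {G : Fin 2 → L2 Ω Plane} (h : IsWeakGradient Ω u G) (hU : IsOpen U) (hUΩ : U ⊆ Ω)
    (A : Plane →ᵃ[ℝ] Plane)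
    (hA : ∀ᵐ x ∂(volume.restrict Ω), x ∈ U → u x = A x) (i : Fin 2) :
    ∀ᵐ x ∂(volume.restrict Ω), x ∈ U → G i x = A.linear (EuclideanSpace.single i 1) := by
  have coord : ∀ j : Fin 2, ∀ᵐ x ∂(volume.restrict Ω), x ∈ U →
      G i x j - A.linear (EuclideanSpace.single i 1) j = 0 := by
    intro j
    have hG : MemLp (fun x => G i x j) 2 (volume.restrict Ω) :=
      ContinuousLinearMap.comp_memLp'
        (EuclideanSpace.proj j : EuclideanSpace ℝ (Fin 2) →L[ℝ] ℝ) (Lp.memLp (G i))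
    refine hU.ae_eq_zero_of_integral_contDiff_smul_eq_zero ?_ ?_
    · exact ((hG.locallyIntegrable (by norm_num)).sub
        (locallyIntegrable_const _)).locallyIntegrableOn _
    · intro φ hφ hc hs
      have off : ∀ x, x ∉ U → φ x = 0 := fun x hx =>
        image_eq_zero_of_notMem_tsupport fun h => hx (hs h)
      have off' : ∀ x, x ∉ U → fderiv ℝ φ x (EuclideanSpace.single i 1) = 0 := fun x hx => by
        have h0 : fderiv ℝ φ x = 0 :=
          image_eq_zero_of_notMem_tsupport fun h => hx (hs (tsupport_fderiv_subset ℝ h))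
        rw [h0]
        rfl
      have e1 := h φ hφ hc (hs.trans hUΩ) i j
      have e2 : ∫ x in Ω, u x j * fderiv ℝ φ x (EuclideanSpace.single i 1)
          = ∫ x, A x j * fderiv ℝ φ x (EuclideanSpace.single i 1) := by
        refine (integral_congr_ae ?_).trans
          (setIntegral_eq_integral_of_forall_compl_eq_zero (s := Ω) fun x hx => ?_)
        · filter_upwards [hA] with x hx
          by_cases hxU : x ∈ U
          · rw [hx hxU]
          · rw [off' x hxU, mul_zero, mul_zero]
        · rw [off' x fun h => hx (hUΩ h), mul_zero]
      have e3 : ∫ x in Ω, A.linear (EuclideanSpace.single i 1) j * φ x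
          = ∫ x, A.linear (EuclideanSpace.single i 1) j * φ x :=
        setIntegral_eq_integral_of_forall_compl_eq_zero fun x hx => by
          rw [off x fun h => hx (hUΩ h), mul_zero]
      rw [e2, integral_affine_mul_fderiv A hφ hc, neg_inj] at e1
      have hi : Integrable (fun x => A.linear (EuclideanSpace.single i 1) j * φ x)
          (volume.restrict Ω) :=
        (continuous_const.mul hφ.continuous).integrable_of_hasCompactSupport hc.mul_left
      calc ∫ x in Ω, φ x • (G i x j - A.linear (EuclideanSpace.single i 1) j)
          = ∫ x in Ω, (G i x j * φ x - A.linear (EuclideanSpace.single i 1) j * φ x) := by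
            refine integral_congr_ae (Eventually.of_forall fun x => ?_)
            simp only [smul_eq_mul]
            ring
        _ = 0 := by
            rw [integral_sub (integrable_coord_mul (G i) j hφ.continuous hc) hi, ← e1, e3, sub_self]
  filter_upwards [coord 0, coord 1] with x h0 h1 hx
  ext j
  fin_cases j
  · exact sub_eq_zero.1 (h0 hx)
  · exact sub_eq_zero.1 (h1 hx)

/-- The constant strain of an affine displacement field. -/
def affineStrain (A : Plane →ᵃ[ℝ] Plane) : Voigt :=
  Matrix.toEuclideanLin !![1, 0; 0, 0; 0, 1] (A.linear (EuclideanSpace.single 0 1))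
    + Matrix.toEuclideanLin !![0, 0; 0, 1; 1, 0] (A.linear (EuclideanSpace.single 1 1))

lemma affineStrain_eq (A : Plane →ᵃ[ℝ] Plane) :
    affineStrain A = !₂[A.linear (EuclideanSpace.single 0 1) 0,
      A.linear (EuclideanSpace.single 1 1) 1,
      A.linear (EuclideanSpace.single 1 1) 0 + A.linear (EuclideanSpace.single 0 1) 1] := by
  ext i
  fin_cases i <;>
    simp [affineStrain, Matrix.toLpLin_apply, dotProduct, Fin.sum_univ_two, add_comm]

lemma IsShape.exists_affine : ∀ {k : ElementKind} {P : Fin k.nodes → Plane} {w : Plane → Plane},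
    IsShape k P w → ∀ i, ∃ A : Plane →ᵃ[ℝ] Plane, ∀ x ∈ subTri P i, w x = A x
  | .tri, _, _, ⟨A, hA⟩, i => ⟨A, fun x hx => hA x (subTri_subset_region _ i hx)⟩
  | .quad, _, _, h, i => h.1 i

namespace Mesh

variable {k : ElementKind} {Ω ΓD : Set Plane}

lemma ae_piece_of_ae_interior (M : Mesh k Ω) (p : Fin M.size × Fin k.nodes) {Q : Plane → Prop}
    (h : ∀ᵐ x ∂(volume.restrict Ω), x ∈ interior (M.piece p) → Q x) :
    ∀ᵐ x ∂(volume.restrict Ω), x ∈ M.piece p → Q x := by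
  have hf : ∀ᵐ x ∂(volume.restrict Ω), x ∉ frontier (M.piece p) :=
    ae_restrict_of_ae (measure_eq_zero_iff_ae_notMem.1 (M.volume_frontier_piece p))
  filter_upwards [h, hf] with x h hf hx
  exact h (by_contra fun hx' => hf ⟨subset_closure hx, hx'⟩)

lemma exists_affine_of_mem_Vh (M : Mesh k Ω) (hΩ : IsPolygonalDomain Ω) {v : admissible Ω ΓD}
    (hv : v ∈ M.Vh ΓD) :
    ∃ (w : Plane → Plane) (A : Fin M.size × Fin k.nodes → Plane →ᵃ[ℝ] Plane),
      (∀ t, IsShape k (M.node t) w) ∧ (∀ p, ∀ x ∈ M.piece p, w x = A p x) ∧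
      ∀ p, ∀ᵐ x ∂(volume.restrict Ω), x ∈ M.piece p →
        strain (v : Jet Ω) x = affineStrain (A p) := by
  obtain ⟨w, -, hw, hs⟩ := hv
  choose A hA using fun p : Fin M.size × Fin k.nodes => (hs p.1).exists_affine p.2
  refine ⟨w, A, hs, hA, fun p => M.ae_piece_of_ae_interior p ?_⟩
  have hwA : ∀ᵐ x ∂(volume.restrict Ω), x ∈ interior (M.piece p) → v.1.1 x = A p x := by
    filter_upwards [hw] with x hx hxp
    rw [hx, hA p x (interior_subset hxp)]
  have hg : ∀ i, ∀ᵐ x ∂(volume.restrict Ω), x ∈ interior (M.piece p) →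
      v.1.2 i x = (A p).linear (EuclideanSpace.single i 1) :=
    IsWeakGradient.ae_eq_of_affine v.2.1 isOpen_interior (M.interior_piece_subset hΩ p)
      (A p) hwA
  filter_upwards [hg 0, hg 1, coeFn_matAct Ω !![1, 0; 0, 0; 0, 1] (v.1.2 0),
    coeFn_matAct Ω !![0, 0; 0, 1; 1, 0] (v.1.2 1), Lp.coeFn_add
      (matAct Ω !![1, 0; 0, 0; 0, 1] (v.1.2 0)) (matAct Ω !![0, 0; 0, 1; 1, 0] (v.1.2 1))]
    with x g0 g1 m0 m1 hadd hx
  rw [strain, hadd, Pi.add_apply, m0, m1, g0 hx, g1 hx, affineStrain]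

end Mesh

/-! ### Smoothing is injective on the strains of discrete displacements -/

lemma affine_sub_apply (A : Plane →ᵃ[ℝ] Plane) (x y : Plane) (l : Fin 2) :
    A y l - A x l = (y 0 - x 0) * A.linear (EuclideanSpace.single 0 1) l
      + (y 1 - x 1) * A.linear (EuclideanSpace.single 1 1) l := by
  have h : y - x = (y 0 - x 0) • EuclideanSpace.single (0 : Fin 2) (1 : ℝ)
      + (y 1 - x 1) • EuclideanSpace.single (1 : Fin 2) (1 : ℝ) := by
    ext i
    fin_cases i <;> simp
  have h2 : A y - A x = A.linear (y - x) := (A.linearMap_vsub y x).symm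
  rw [← PiLp.sub_apply, h2, h, map_add, map_smul, map_smul]
  rfl

/-- The product `(w y - w x) ⬝ (y - x)`, the first order change of the squared length of the
segment from `x` to `y` under the displacement field `w`. -/
def stretch (w : Plane → Plane) (x y : Plane) : ℝ :=
  (w y 0 - w x 0) * (y 0 - x 0) + (w y 1 - w x 1) * (y 1 - x 1)

lemma stretch_comm (w : Plane → Plane) (x y : Plane) : stretch w x y = stretch w y x := by
  simp only [stretch]; ring

/-- The component of a strain in the direction `d`. -/
def normalComponent (d : Plane) : Voigt →ₗ[ℝ] ℝ where
  toFun ε := ε 0 * d 0 ^ 2 + ε 1 * d 1 ^ 2 + ε 2 * (d 0 * d 1)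
  map_add' ε δ := by simp only [PiLp.add_apply]; ring
  map_smul' c ε := by simp only [PiLp.smul_apply, smul_eq_mul, RingHom.id_apply]; ring

lemma normalComponent_sub_comm (x y : Plane) (ε : Voigt) :
    normalComponent (x - y) ε = normalComponent (y - x) ε := by
  simp only [normalComponent, LinearMap.coe_mk, AddHom.coe_mk, PiLp.sub_apply]; ring

/-- The quadratic form of a gradient sees only its symmetric part. The third strain entry is the
doubled shear, hence the coefficient `1` of `d 0 * d 1`. -/
lemma stretch_affine (A : Plane →ᵃ[ℝ] Plane) (x y : Plane) :
    stretch A x y = normalComponent (y - x) (affineStrain A) := by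
  simp only [stretch, affine_sub_apply, affineStrain_eq, normalComponent, LinearMap.coe_mk,
    AddHom.coe_mk, PiLp.sub_apply, Matrix.cons_val]
  ring

/-- Three noncollinear points determine an affine map; the two combinations below are Cramer's rule.
-/
lemma affineStrain_congr {A R : Plane →ᵃ[ℝ] Plane} {a b c : Plane} (h : 0 < orient a b c)
    (ha : A a = R a) (hb : A b = R b) (hc : A c = R c) : affineStrain A = affineStrain R := by
  have key : ∀ l : Fin 2,
      A.linear (EuclideanSpace.single 0 1) l = R.linear (EuclideanSpace.single 0 1) l ∧
      A.linear (EuclideanSpace.single 1 1) l = R.linear (EuclideanSpace.single 1 1) l := by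
    intro l
    have e1 := affine_sub_apply A a b l
    have e2 := affine_sub_apply A a c l
    rw [hb, ha, affine_sub_apply] at e1
    rw [hc, ha, affine_sub_apply] at e2
    simp only [orient] at h
    constructor
    · refine mul_left_cancel₀ h.ne' ?_
      linear_combination (b 1 - a 1) * e2 - (c 1 - a 1) * e1
    · refine mul_left_cancel₀ h.ne' ?_
      linear_combination (c 0 - a 0) * e1 - (b 0 - a 0) * e2
  rw [affineStrain_eq, affineStrain_eq, (key 0).1, (key 0).2, (key 1).1, (key 1).2]

lemma eq_zero_of_orthogonal {z a b c : Plane} (h : 0 < orient a b c)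
    (hb : z 0 * (b 0 - a 0) + z 1 * (b 1 - a 1) = 0)
    (hc : z 0 * (c 0 - a 0) + z 1 * (c 1 - a 1) = 0) (l : Fin 2) : z l = 0 := by
  simp only [orient] at h
  fin_cases l
  · refine (mul_eq_zero.1 ?_).resolve_right h.ne'
    simp only [Fin.zero_eta]
    linear_combination (c 1 - a 1) * hb - (b 1 - a 1) * hc
  · refine (mul_eq_zero.1 ?_).resolve_right h.ne'
    simp only [Fin.mk_one]
    linear_combination (b 0 - a 0) * hc - (c 0 - a 0) * hb

/-- A shape function on a quadrilateral that preserves the edge lengths to first order and is rigid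
on one subtriangle is rigid at the nodes. -/
lemma quad_eq_rigid {P : Fin ElementKind.quad.nodes → Plane} {w : Plane → Plane}
    (hP : ∀ i, 0 < orient (center P) (P i) (P (i + 1))) (hw : IsShape .quad P w)
    (hs : ∀ i, stretch w (P i) (P (i + 1)) = 0) {i : Fin ElementKind.quad.nodes}
    {R : Plane →ᵃ[ℝ] Plane} (hR : ∀ x ∈ subTri P i, w x = R x) (hR0 : affineStrain R = 0)
    (j : Fin ElementKind.quad.nodes) : w (P j) = R (P j) := by
  have hc := hR _ (center_mem_subTri P i)
  have h0 := hR _ (node_mem_subTri P i)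
  have h1 := hR _ (next_mem_subTri P i)
  have rigid : ∀ x y, stretch R x y = 0 := fun x y => by rw [stretch_affine, hR0, map_zero]
  -- The deviation `w - R` has center value equal to the mean of its nodal values. It vanishes at
  -- the center and at nodes `i`, `i + 1`, so it takes opposite values `z` and `-z` at the other
  -- two.
  have mean : ∀ l : Fin 2, (w (P (i + 1 + 1)) l - R (P (i + 1 + 1)) l)
      + (w (P (i + 1 + 1 + 1)) l - R (P (i + 1 + 1 + 1)) l) = 0 := by
    intro l
    have e1 : 4 * w (center P) l = w (P i) l + w (P (i + 1)) l + w (P (i + 1 + 1)) l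
        + w (P (i + 1 + 1 + 1)) l := by
      rw [hw.2, quad_sum (fun i => w (P i)) i]
      simp only [PiLp.add_apply, PiLp.smul_apply, smul_eq_mul]
      ring
    rw [hc, h0, h1] at e1
    have a0 := affine_sub_apply R (center P) (P i) l
    have a1 := affine_sub_apply R (center P) (P (i + 1)) l
    have a2 := affine_sub_apply R (center P) (P (i + 1 + 1)) l
    have a3 := affine_sub_apply R (center P) (P (i + 1 + 1 + 1)) l
    have c0 := quad_center_eq P i 0
    have c1 := quad_center_eq P i 1
    linear_combination -e1 - a0 - a1 - a2 - a3
      + R.linear (EuclideanSpace.single 0 1) l * c0 + R.linear (EuclideanSpace.single 1 1) l * c1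
  obtain ⟨z, hz⟩ : ∃ z : Plane, ∀ l, z l = w (P (i + 1 + 1)) l - R (P (i + 1 + 1)) l :=
    ⟨w (P (i + 1 + 1)) - R (P (i + 1 + 1)), fun _ => rfl⟩
  have s1 := hs (i + 1)
  have s2 := hs (i + 1 + 1)
  have s3 := hs (i + 1 + 1 + 1)
  rw [quad_index_add_four] at s3
  have r1 := rigid (P (i + 1)) (P (i + 1 + 1))
  have r2 := rigid (P (i + 1 + 1)) (P (i + 1 + 1 + 1))
  have r3 := rigid (P (i + 1 + 1 + 1)) (P i)
  simp only [stretch, h0, h1] at s1 s2 s3 r1 r2 r3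
  have m0 := mean 0
  have m1 := mean 1
  have z0 := hz 0
  have z1 := hz 1
  rw [← hz] at m0 m1
  -- The deviation also has zero stretch along each edge. Its increments along the three edges other
  -- than `i` are `z`, `-2 z` and `z`, so `z` is orthogonal to all three.
  have d1 : z 0 * (P (i + 1 + 1) 0 - P (i + 1) 0) + z 1 * (P (i + 1 + 1) 1 - P (i + 1) 1) = 0 := by
    rw [z0, z1]; linear_combination s1 - r1
  have d2 : z 0 * (P (i + 1 + 1 + 1) 0 - P (i + 1 + 1) 0)
      + z 1 * (P (i + 1 + 1 + 1) 1 - P (i + 1 + 1) 1) = 0 := by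
    linear_combination (-1 / 2) * s2 + (1 / 2) * r2
      + (1 / 2) * (P (i + 1 + 1 + 1) 0 - P (i + 1 + 1) 0) * (m0 + z0)
      + (1 / 2) * (P (i + 1 + 1 + 1) 1 - P (i + 1 + 1) 1) * (m1 + z1)
  have d3 : z 0 * (P i 0 - P (i + 1 + 1 + 1) 0) + z 1 * (P i 1 - P (i + 1 + 1 + 1) 1) = 0 := by
    linear_combination s3 - r3 + (P i 0 - P (i + 1 + 1 + 1) 0) * m0
      + (P i 1 - P (i + 1 + 1 + 1) 1) * m1
  have c0 := quad_center_eq P i 0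
  have c1 := quad_center_eq P i 1
  -- `P i - center P` is `1/4`, `1/2` and `3/4` of the three edge vectors, added up. With `P (i + 1)
  -- - center P` it spans the plane, so `z = 0`.
  have o0 : z 0 * (P i 0 - center P 0) + z 1 * (P i 1 - center P 1) = 0 := by
    linear_combination (-1 / 4) * (z 0 * c0 + z 1 * c1) + (1 / 4) * d1 + (1 / 2) * d2
      + (3 / 4) * d3
  have o1 : z 0 * (P (i + 1) 0 - center P 0) + z 1 * (P (i + 1) 1 - center P 1) = 0 := by
    linear_combination o0 - d1 - d2 - d3
  have hz0 := eq_zero_of_orthogonal (hP i) o0 o1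
  have h2 : w (P (i + 1 + 1)) = R (P (i + 1 + 1)) := by
    ext l
    rw [← sub_eq_zero, ← hz, hz0]
  have h3 : w (P (i + 1 + 1 + 1)) = R (P (i + 1 + 1 + 1)) := by
    ext l
    have := mean l
    rw [← hz, hz0, zero_add] at this
    exact sub_eq_zero.1 this
  by_cases hij : i = j
  · rw [← hij, h0]
  · rcases quad_index_cases i j hij with rfl | rfl | rfl
    · exact h1
    · rwa [quad_index_add_four] at h3
    · exact h2

lemma IsShape.affineStrain_eq_zero : ∀ {k : ElementKind} {P : Fin k.nodes → Plane}
    {w : Plane → Plane} {A : Fin k.nodes → Plane →ᵃ[ℝ] Plane}, IsShape k P w →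
    (∀ i, 0 < orient (center P) (P i) (P (i + 1))) → (∀ i, ∀ x ∈ subTri P i, w x = A i x) →
    (∀ i, stretch w (P i) (P (i + 1)) = 0) → ∀ {i : Fin k.nodes}, affineStrain (A i) = 0 →
    ∀ j, affineStrain (A j) = 0
  | .tri, P, w, A, ⟨B, hB⟩, hP, hA, _, i, hi, j => by
    have h : ∀ l, affineStrain (A l) = affineStrain B := by
      intro l
      have agree : ∀ x ∈ subTri P l, A l x = B x := fun x hx => by
        rw [← hA l x hx, hB x (subTri_subset_region P l hx)]
      exact affineStrain_congr (hP l) (agree _ (center_mem_subTri P l))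
        (agree _ (node_mem_subTri P l)) (agree _ (next_mem_subTri P l))
    rw [h, ← h i, hi]
  | .quad, P, w, A, hw, hP, hA, hs, i, hi, j => by
    have h := quad_eq_rigid hP hw hs (hA i) hi
    have hc : A j (center P) = A i (center P) := by
      rw [← hA j _ (center_mem_subTri P j), ← hA i _ (center_mem_subTri P i)]
    rw [← hi]
    refine affineStrain_congr (hP j) hc ?_ ?_
    · rw [← hA j _ (node_mem_subTri P j), h]
    · rw [← hA j _ (next_mem_subTri P j), h]

/-! ### The farthest node argument -/

lemma dot_center_le {n : ℕ} [NeZero n] {P : Fin n → Plane} {v : Plane} {r : ℝ}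
    (h : ∀ i, v 0 * P i 0 + v 1 * P i 1 ≤ r) : v 0 * center P 0 + v 1 * center P 1 ≤ r := by
  have hn : (0 : ℝ) < n := Nat.cast_pos.2 (NeZero.pos n)
  have hc : v 0 * center P 0 + v 1 * center P 1
      = (1 / (n : ℝ)) * ∑ i, (v 0 * P i 0 + v 1 * P i 1) := by
    simp only [center, PiLp.smul_apply, smul_eq_mul, WithLp.ofLp_sum, Finset.sum_apply,
      Finset.sum_add_distrib, ← Finset.mul_sum]
    ring
  have hsum : ∑ i, (v 0 * P i 0 + v 1 * P i 1) ≤ n * r := by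
    have := Finset.sum_le_sum fun i (_ : i ∈ Finset.univ) => h i
    simpa using this
  rw [hc, one_div, inv_mul_le_iff₀ hn]
  exact hsum

namespace Mesh

variable {k : ElementKind} {Ω : Set Plane}

/-- A set of elements such that every edge of an element of the set is shared with another element
of the set is empty: consider the angles at the node farthest from the origin. -/
lemma eq_empty_of_forall_exists_adjacent (M : Mesh k Ω) (S : Set (Fin M.size))
    (hS : ∀ t ∈ S, ∀ i, ∃ t' ∈ S, ∃ j, (t', j) ≠ (t, i) ∧ M.base (t', j) = M.base (t, i)) :
    S = ∅ := by
  classical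
  by_contra hne
  obtain ⟨t₀, ht₀⟩ := nonempty_iff_ne_empty.2 hne
  let nd : Fin M.size × Fin k.nodes → Plane := fun p => M.node p.1 p.2
  let F : Finset (Fin M.size × Fin k.nodes) := Finset.univ.filter fun p => p.1 ∈ S
  obtain ⟨p₀, hp₀, hmax⟩ := F.exists_max_image (fun p => nd p 0 ^ 2 + nd p 1 ^ 2)
    ⟨(t₀, 0), by simpa [F] using ht₀⟩
  obtain ⟨v, hv⟩ : ∃ v, v = nd p₀ := ⟨_, rfl⟩
  have hmax' : ∀ t ∈ S, ∀ i, M.node t i 0 ^ 2 + M.node t i 1 ^ 2 ≤ v 0 ^ 2 + v 1 ^ 2 := by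
    intro t ht i
    rw [hv]
    exact hmax (t, i) (by simpa [F] using ht)
  -- Seen from `v`, `f` is minus the tangent of the counterclockwise angle from the inward direction
  -- `-v` to the node, so its minimum is the edge turned farthest counterclockwise.
  let f : Fin M.size × Fin k.nodes → ℝ := fun p =>
    (v 0 * (nd p 1 - v 1) - v 1 * (nd p 0 - v 0))
      / -(v 0 * (nd p 0 - v 0) + v 1 * (nd p 1 - v 1))
  -- The edges arriving at `v`. Since nodes run counterclockwise, such an edge bounds the sector of
  -- its element at `v` on the counterclockwise side.
  let E : Finset (Fin M.size × Fin k.nodes) :=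
    Finset.univ.filter fun p => p.1 ∈ S ∧ M.node p.1 (p.2 + 1) = v
  obtain ⟨⟨t, i⟩, hti, hmin⟩ := E.exists_min_image f
    ⟨(p₀.1, p₀.2 - 1), by
      have : p₀.1 ∈ S := by simpa [F] using hp₀
      simp [E, this, hv, nd]⟩
  obtain ⟨ht, hvi⟩ : t ∈ S ∧ M.node t (i + 1) = v := by simpa [E] using hti
  obtain ⟨t', ht', j, hne', hbase⟩ := hS t ht i
  have hrev : M.node t' j = v ∧ M.node t' (j + 1) = M.node t i := by
    rcases Sym2.eq_iff.1 hbase with ⟨h1, h2⟩ | ⟨h1, h2⟩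
    · exact absurd (M.eq_of_node_eq (p := (t', j)) (q := (t, i)) h1 h2) hne'
    · exact ⟨h1.trans hvi, h2⟩
  -- The neighbor `t'` lies beyond the extreme edge, so its own arriving edge at `v` should be
  -- turned still farther, against minimality.
  have hle := hmin (t', j - 1) (by simp [E, ht', hrev.1])
  have o1 := M.nondegenerate t' j
  have o2 := M.nondegenerate t' (j - 1)
  rw [sub_add_cancel] at o2
  rw [hrev.1, hrev.2] at o1
  rw [hrev.1] at o2
  have n1 := ne_of_orient_pos_right o1
  have n2 := ne_of_orient_pos_right o2
  -- The disc through `v` is strictly convex, so every other node lies strictly on the inner side of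
  -- the tangent at `v`, and the denominators of `f` are positive.
  have pos : ∀ x : Plane, x ≠ v → x 0 ^ 2 + x 1 ^ 2 ≤ v 0 ^ 2 + v 1 ^ 2 →
      0 < -(v 0 * (x 0 - v 0) + v 1 * (x 1 - v 1)) := by
    intro x hxv hx
    have hsq : 0 < (x 0 - v 0) ^ 2 + (x 1 - v 1) ^ 2 := by
      by_contra hcon
      have h0 : x 0 - v 0 = 0 := by nlinarith [sq_nonneg (x 0 - v 0), sq_nonneg (x 1 - v 1)]
      have h1 : x 1 - v 1 = 0 := by nlinarith [sq_nonneg (x 0 - v 0), sq_nonneg (x 1 - v 1)]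
      apply hxv
      ext l
      fin_cases l
      · exact sub_eq_zero.1 h0
      · exact sub_eq_zero.1 h1
    linarith
  have ha := pos _ n1.symm (hmax' t ht i)
  have hd := pos _ n2 (hmax' t' ht' (j - 1))
  have hb : v 0 * center (M.node t') 0 + v 1 * center (M.node t') 1 ≤ v 0 ^ 2 + v 1 ^ 2 :=
    dot_center_le fun l => by
      nlinarith [hmax' t' ht' l, sq_nonneg (M.node t' l 0 - v 0), sq_nonneg (M.node t' l 1 - v 1)]
  simp only [f, nd] at hle
  rw [div_le_div_iff₀ ha hd] at hle
  generalize M.node t i = a at *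
  generalize M.node t' (j - 1) = d at *
  generalize center (M.node t') = b at *
  have hvv : 0 ≤ v 0 ^ 2 + v 1 ^ 2 := by positivity
  -- Cleared of denominators, minimality says that `|v|²` times the cross product of `a - v` and `d
  -- - v` is at most `0`.
  have hcross : (a 0 - v 0) * (d 1 - v 1) - (a 1 - v 1) * (d 0 - v 0) ≤ 0 ∨
      v 0 ^ 2 + v 1 ^ 2 ≤ 0 := by
    by_contra! hcon
    nlinarith [mul_pos hcon.1 hcon.2]
  have hv0 : 0 < v 0 ^ 2 + v 1 ^ 2 := by
    rcases hvv.lt_or_eq with h | h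
    · exact h
    · have h0 : v 0 = 0 := by nlinarith [sq_nonneg (v 0), sq_nonneg (v 1)]
      have h1 : v 1 = 0 := by nlinarith [sq_nonneg (v 0), sq_nonneg (v 1)]
      rw [h0, h1] at ha
      norm_num at ha
  have hc := hcross.resolve_right (not_le.2 hv0)
  simp only [orient] at o1 o2
  have i1 : 0 < ((a 0 - v 0) * (b 1 - v 1) - (a 1 - v 1) * (b 0 - v 0)) := by linarith
  have i2 : 0 < ((b 0 - v 0) * (d 1 - v 1) - (b 1 - v 1) * (d 0 - v 0)) := by linarith
  have hb' : 0 ≤ -(v 0 * (b 0 - v 0) + v 1 * (b 1 - v 1)) := by linarith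
  -- With `a`, `b`, `d` taken relative to `v` and `n = -v`, the identity `(a × b)(n · d) + (b × d)(n
  -- · a) = (a × d)(n · b)` has a positive left side and a nonpositive right side.
  have p1 := mul_pos i1 hd
  have p2 := mul_pos i2 ha
  have p3 := mul_nonneg (neg_nonneg.2 hc) hb'
  linarith

lemma affineStrain_eq_zero_of_sum_eq_zero (M : Mesh k Ω) {w : Plane → Plane}
    {A : Fin M.size × Fin k.nodes → Plane →ᵃ[ℝ] Plane} (hw : ∀ t, IsShape k (M.node t) w)
    (hA : ∀ p, ∀ x ∈ M.piece p, w x = A p x) {a : Fin M.size × Fin k.nodes → ℝ}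
    (ha : ∀ p, 0 < a p)
    (h : ∀ p, ∑ q : {q // M.base q = M.base p}, a q • affineStrain (A q) = 0)
    (p : Fin M.size × Fin k.nodes) : affineStrain (A p) = 0 := by
  have hstretch : ∀ q, stretch w (M.node q.1 q.2) (M.node q.1 (q.2 + 1))
      = normalComponent (M.node q.1 (q.2 + 1) - M.node q.1 q.2) (affineStrain (A q)) := by
    intro q
    rw [← stretch_affine, stretch, stretch, hA q _ (node_mem_subTri _ _),
      hA q _ (next_mem_subTri _ _)]
  have hzero : ∀ p : Fin M.size × Fin k.nodes,
      stretch w (M.node p.1 p.2) (M.node p.1 (p.2 + 1)) = 0 := by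
    intro p
    -- All subtriangles on an edge have the same strain component along it, so the weighted sum over
    -- the cell is a positive multiple of that component.
    have hsame : ∀ q : {q // M.base q = M.base p},
        normalComponent (M.node p.1 (p.2 + 1) - M.node p.1 p.2) (affineStrain (A q))
          = stretch w (M.node p.1 p.2) (M.node p.1 (p.2 + 1)) := by
      rintro ⟨q, hq⟩
      rcases Sym2.eq_iff.1 hq with ⟨h1, h2⟩ | ⟨h1, h2⟩
      · rw [← h1, ← h2, hstretch]
      · rw [← h1, ← h2, stretch_comm, hstretch, normalComponent_sub_comm]
    have hsum := congrArg (normalComponent (M.node p.1 (p.2 + 1) - M.node p.1 p.2)) (h p)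
    simp only [map_sum, map_smul, map_zero, hsame, smul_eq_mul, ← Finset.sum_mul] at hsum
    refine (mul_eq_zero.1 hsum).resolve_left (ne_of_gt ?_)
    exact Finset.sum_pos (fun q _ => ha q) ⟨⟨p, rfl⟩, Finset.mem_univ _⟩
  have hall : ∀ t i, affineStrain (A (t, i)) = 0 → ∀ j, affineStrain (A (t, j)) = 0 :=
    fun t i hi => (hw t).affineStrain_eq_zero (A := fun i => A (t, i)) (M.nondegenerate t)
      (fun i => hA (t, i)) (fun i => hzero (t, i)) hi
  have hempty := M.eq_empty_of_forall_exists_adjacent {t | ∃ i, affineStrain (A (t, i)) ≠ 0} ?_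
  · by_contra hp
    have : p.1 ∈ {t | ∃ i, affineStrain (A (t, i)) ≠ 0} := ⟨p.2, hp⟩
    rw [hempty] at this
    exact this
  · rintro t ⟨i₀, hi₀⟩ i
    have hi : affineStrain (A (t, i)) ≠ 0 := fun h0 => hi₀ (hall t i h0 i₀)
    -- If no other strained subtriangle had this base, the sum over the cell would reduce to one
    -- nonzero term.
    by_contra! hcon
    refine hi ((smul_eq_zero.1 ?_).resolve_left (ha (t, i)).ne')
    rw [← h (t, i)]
    symm
    apply Fintype.sum_eq_single (⟨(t, i), rfl⟩ : {q // M.base q = M.base (t, i)})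
    rintro ⟨⟨t', j⟩, hq⟩ hne
    by_cases h0 : affineStrain (A (t', j)) = 0
    · rw [h0, smul_zero]
    · exact absurd hq (hcon t' ⟨j, h0⟩ j fun heq => hne (Subtype.ext heq))

lemma strain_eq_zero_of_smoothedStrain_eq_zero {ΓD : Set Plane} (M : Mesh k Ω)
    (hΩ : IsPolygonalDomain Ω) {v : admissible Ω ΓD} (hv : v ∈ M.Vh ΓD)
    (h : M.smoothedStrain (v : Jet Ω) = 0) : strain (v : Jet Ω) = 0 := by
  obtain ⟨w, A, hw, hA, hs⟩ := M.exists_affine_of_mem_Vh hΩ hv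
  have hint : ∀ p, ∫ x in M.piece p, strain (v : Jet Ω) x ∂(volume.restrict Ω)
      = (volume.restrict Ω).real (M.piece p) • affineStrain (A p) := fun p => by
    rw [← setIntegral_const]
    exact setIntegral_congr_ae (M.measurableSet_piece p) (hs p)
  have hzero := M.affineStrain_eq_zero_of_sum_eq_zero hw hA
    (a := fun p => (volume.restrict Ω).real (M.piece p))
    (fun p => ENNReal.toReal_pos (M.measure_piece_pos hΩ p).ne' (M.measure_piece_ne_top p)) ?_
  · apply Lp.ext
    filter_upwards [Lp.coeFn_zero Voigt 2 (volume.restrict Ω), ae_all_iff.2 hs,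
      M.ae_exists_mem_piece hΩ] with x h0 h1 ⟨p, hp⟩
    rw [h1 p hp, hzero, h0, Pi.zero_apply]
  · intro p
    have hcell := M.setIntegral_cell_P1h (strain (v : Jet Ω)) (M.base_mem_edges p)
    rw [setIntegral_cell, setIntegral_cell] at hcell
    simp only [← hint]
    rw [← hcell]
    refine Finset.sum_eq_zero fun q _ => integral_eq_zero_of_ae ?_
    have h0 : M.P1h (strain (v : Jet Ω)) = 0 := h
    rw [h0]
    exact ae_restrict_of_ae (Lp.coeFn_zero _ _ _)

end Mesh

/-! ### Stability and the error estimate -/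

namespace Mesh

variable {k : ElementKind} {Ω ΓD : Set Plane} {B : Matrix (Fin 3) (Fin 3) ℝ}

/-- The strains of the discrete displacements. -/
def strainSpace (M : Mesh k Ω) (ΓD : Set Plane) : Submodule ℝ (W Ω) :=
  (M.Vh ΓD).map ((strainLinear Ω).comp (admissible Ω ΓD).subtype)

/-- A discrete strain is constant on each subtriangle, hence determined by the integrals of its
three components there. -/
lemma finiteDimensional_strainSpace (M : Mesh k Ω) (hΩ : IsPolygonalDomain Ω) (ΓD : Set Plane) :
    FiniteDimensional ℝ (M.strainSpace ΓD) := by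
  let Φ : W Ω →ₗ[ℝ] (Fin M.size × Fin k.nodes) × Fin 3 → ℝ := LinearMap.pi fun q =>
    (innerSL ℝ (indicatorConstLp 2 (M.measurableSet_piece q.1) (M.measure_piece_ne_top q.1)
      (EuclideanSpace.single q.2 (1 : ℝ)) : W Ω) : W Ω →L[ℝ] ℝ)
  refine FiniteDimensional.of_injective (Φ.comp (M.strainSpace ΓD).subtype) ?_
  rw [← LinearMap.ker_eq_bot, LinearMap.ker_eq_bot']
  rintro ⟨_, ⟨v, hv, rfl⟩⟩ h0
  obtain ⟨w, A, -, -, hs⟩ := M.exists_affine_of_mem_Vh hΩ hv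
  have hs' : ∀ p, ∀ᵐ x ∂(volume.restrict Ω), x ∈ M.piece p → strain (v : Jet Ω) x = 0 := by
    intro p
    have hA : affineStrain (A p) = 0 := by
      ext l
      have h1 : inner ℝ (indicatorConstLp 2 (M.measurableSet_piece p) (M.measure_piece_ne_top p)
          (EuclideanSpace.single l (1 : ℝ)) : W Ω) (strain (v : Jet Ω)) = 0 := congrFun h0 (p, l)
      rw [L2.inner_indicatorConstLp_eq_inner_setIntegral,
        setIntegral_congr_ae (M.measurableSet_piece p) (hs p), setIntegral_const,
        inner_smul_right, EuclideanSpace.inner_single_left] at h1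
      have hpos : 0 < (volume.restrict Ω).real (M.piece p) :=
        ENNReal.toReal_pos (M.measure_piece_pos hΩ p).ne' (M.measure_piece_ne_top p)
      simpa using (mul_eq_zero.1 h1).resolve_left hpos.ne'
    simpa only [hA] using hs p
  refine Subtype.ext (Lp.ext ?_)
  filter_upwards [Lp.coeFn_zero Voigt 2 (volume.restrict Ω), ae_all_iff.2 hs',
    M.ae_exists_mem_piece hΩ] with x h1 h2 ⟨p, hp⟩
  exact (h2 p hp).trans h1.symm

lemma exists_smoothedStrain_bound (M : Mesh k Ω) (hΩ : IsPolygonalDomain Ω) (ΓD : Set Plane)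
    (hB : IsUnit B.det) : ∃ C : ℝ, 0 < C ∧ ∀ v ∈ M.Vh ΓD,
      C * ‖matAct Ω B (strain (v : Jet Ω))‖ ≤ ‖matAct Ω B (M.smoothedStrain (v : Jet Ω))‖ := by
  have := M.finiteDimensional_strainSpace hΩ ΓD
  let f : M.strainSpace ΓD →ₗ[ℝ] W Ω :=
    (matAct Ω B : W Ω →ₗ[ℝ] W Ω).comp ((M.P1hLinear hΩ).comp (M.strainSpace ΓD).subtype)
  obtain ⟨K, hK, hf⟩ := f.exists_antilipschitzWith (by
    rw [LinearMap.ker_eq_bot']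
    rintro ⟨_, ⟨v, hv, rfl⟩⟩ h0
    have h1 : matAct Ω B (M.smoothedStrain (v : Jet Ω)) = 0 := h0
    have h2 : M.smoothedStrain (v : Jet Ω) = 0 := by
      rw [← matAct_inv_matAct hB (M.smoothedStrain (v : Jet Ω)), h1, map_zero]
    exact Subtype.ext (M.strain_eq_zero_of_smoothedStrain_eq_zero hΩ hv h2))
  have hK' : (0 : ℝ) < K := hK
  -- `K` comes from injectivity in finite dimension; the summand `1` keeps the constant positive
  -- without knowing that `‖matAct Ω B‖` is.
  refine ⟨((‖matAct Ω B‖ + 1) * K)⁻¹, by positivity, fun v hv => ?_⟩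
  rw [inv_mul_le_iff₀ (by positivity)]
  have h1 : ‖strain (v : Jet Ω)‖ ≤ K * ‖matAct Ω B (M.smoothedStrain (v : Jet Ω))‖ :=
    hf.le_mul_norm (map_zero f) ⟨strain (v : Jet Ω), ⟨v, hv, rfl⟩⟩
  calc ‖matAct Ω B (strain (v : Jet Ω))‖ ≤ ‖matAct Ω B‖ * ‖strain (v : Jet Ω)‖ :=
        (matAct Ω B).le_opNorm _
    _ ≤ (‖matAct Ω B‖ + 1) * (K * ‖matAct Ω B (M.smoothedStrain (v : Jet Ω))‖) := by
        gcongr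
        linarith
    _ = _ := by ring

lemma smoothedStrain_mem_W1h (M : Mesh k Ω) (p : Jet Ω) : M.smoothedStrain p ∈ M.W1h :=
  M.P1h_mem_W1h _

lemma inner_smoothedStrain (M : Mesh k Ω) (hΩ : IsPolygonalDomain Ω) {τ : W Ω} (hτ : τ ∈ M.W1h)
    (p : Jet Ω) : inner ℝ τ (M.smoothedStrain p) = inner ℝ τ (strain p) :=
  M.inner_P1h hΩ hτ _

lemma eq_of_mem_kernelZ {U : PiSpace Ω ΓD} (hU : U ∈ kernelZ Ω ΓD) :
    U.2.1 = strain (U.1 : Jet Ω) ∧ U.2.2 = strain (U.1 : Jet Ω) := by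
  have h1 := hU (strain (U.1 : Jet Ω) - U.2.1, 0)
  have h2 := hU (0, U.2.1 - U.2.2)
  simp only [mixedForm, inner_zero_left, add_zero, zero_add, inner_self_eq_zero, sub_eq_zero]
    at h1 h2
  exact ⟨h1.symm, by rw [← h2, h1]⟩

lemma eq_of_mem_kernelZh (M : Mesh k Ω) (hΩ : IsPolygonalDomain Ω) {U : PiSpace Ω ΓD}
    (hU : U ∈ M.kernelZh ΓD) :
    U.2.1 = M.smoothedStrain (U.1 : Jet Ω) ∧ U.2.2 = M.smoothedStrain (U.1 : Jet Ω) := by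
  obtain ⟨-, h1, h2, h⟩ := hU
  have e1 : U.2.1 = M.smoothedStrain (U.1 : Jet Ω) := M.eq_P1h hΩ h1 fun τ hτ => by
    have := h (τ, 0) hτ M.W1h.zero_mem
    simp only [mixedForm, inner_zero_left, inner_sub_right] at this
    linarith
  have e2 := h (0, U.2.1 - U.2.2) M.W1h.zero_mem (M.W1h.sub_mem h1 h2)
  simp only [mixedForm, inner_zero_left, zero_add, inner_self_eq_zero, sub_eq_zero] at e2
  exact ⟨e1, by rw [← e2, e1]⟩

lemma mem_kernelZh (M : Mesh k Ω) (hΩ : IsPolygonalDomain Ω) {v : admissible Ω ΓD}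
    (hv : v ∈ M.Vh ΓD) :
    ((v, M.smoothedStrain (v : Jet Ω), M.smoothedStrain (v : Jet Ω)) : PiSpace Ω ΓD)
      ∈ M.kernelZh ΓD := by
  refine ⟨hv, M.smoothedStrain_mem_W1h _, M.smoothedStrain_mem_W1h _, fun Q h1 _ => ?_⟩
  simp only [mixedForm, sub_self, inner_zero_right, add_zero, inner_sub_right,
    M.inner_smoothedStrain hΩ h1]

lemma exists_isStabilityConstant (M : Mesh k Ω) (hΩ : IsPolygonalDomain Ω) (ΓD : Set Plane)
    (hB : IsUnit B.det) : ∃ α : ℝ, M.IsStabilityConstant ΓD (B.transpose * B) α := by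
  obtain ⟨C₀, hC₀, hCb⟩ := M.exists_smoothedStrain_bound hΩ ΓD hB
  -- Capping `C` at `1` lets the same bound serve on `Z`, where no smoothing occurs.
  obtain ⟨C, hC, hCC₀, hC1⟩ : ∃ C : ℝ, 0 < C ∧ C ≤ C₀ ∧ C ≤ 1 :=
    ⟨min C₀ 1, lt_min hC₀ one_pos, min_le_left _ _, min_le_right _ _⟩
  have bound : ∀ {a b : ℝ}, 0 ≤ a → C * a ≤ b →
      (√(1 / C ^ 2 + 2))⁻¹ * √(a ^ 2 + b ^ 2 + b ^ 2) ≤ b := by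
    intro a b ha h
    have hb : 0 ≤ b := (by positivity : 0 ≤ C * a).trans h
    have hab : a ^ 2 ≤ 1 / C ^ 2 * b ^ 2 := by
      rw [one_div, le_inv_mul_iff₀ (by positivity), ← mul_pow]
      gcongr
    rw [inv_mul_le_iff₀ (by positivity)]
    calc √(a ^ 2 + b ^ 2 + b ^ 2) ≤ √((1 / C ^ 2 + 2) * b ^ 2) :=
          Real.sqrt_le_sqrt (by linarith)
      _ = √(1 / C ^ 2 + 2) * b := by rw [Real.sqrt_mul (by positivity), Real.sqrt_sq hb]
  refine ⟨(√(1 / C ^ 2 + 2))⁻¹, by positivity, ?_⟩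
  rintro U (hU | hU)
  · obtain ⟨e1, e2⟩ := eq_of_mem_kernelZ hU
    simp only [piNorm, piSeminorm, e1, e2, strainNorm_transpose_mul_self]
    exact bound (norm_nonneg _) (mul_le_of_le_one_left (norm_nonneg _) hC1)
  · obtain ⟨e1, e2⟩ := M.eq_of_mem_kernelZh hΩ hU
    simp only [piNorm, piSeminorm, e1, e2, strainNorm_transpose_mul_self]
    exact bound (norm_nonneg _)
      ((mul_le_mul_of_nonneg_right hCC₀ (norm_nonneg _)).trans (hCb U.1 hU.1))

/-- Pythagoras in the energy product: `D` applied to the smoothed strain is cellwise constant, hence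
orthogonal to the smoothing error. -/
lemma norm_strain_sub_smoothedStrain_le (M : Mesh k Ω) (hΩ : IsPolygonalDomain Ω) (p : Jet Ω) :
    ‖matAct Ω B (strain p - M.smoothedStrain p)‖ ≤ ‖matAct Ω B (strain p)‖ := by
  have horth : inner ℝ (matAct Ω B (M.smoothedStrain p))
      (matAct Ω B (strain p - M.smoothedStrain p)) = 0 := by
    rw [← inner_matAct_transpose_mul_self, inner_sub_right,
      M.inner_smoothedStrain hΩ (M.matAct_mem_W1h _ (M.smoothedStrain_mem_W1h p)), sub_self]
  have hpy := norm_add_sq_eq_norm_sq_add_norm_sq_of_inner_eq_zero _ _ horth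
  rw [← map_add, add_sub_cancel] at hpy
  nlinarith [norm_nonneg (matAct Ω B (strain p)), norm_nonneg (matAct Ω B (strain p -
    M.smoothedStrain p)), mul_self_nonneg ‖matAct Ω B (M.smoothedStrain p)‖]

/-- The difference between the discrete solution and any discrete displacement, in terms of the
best approximations of strain and stress. -/
lemma norm_smoothedStrain_sub_le (M : Mesh k Ω) (hΩ : IsPolygonalDomain Ω) (hB : IsUnit B.det)
    {α : ℝ} (hα : M.IsStabilityConstant ΓD (B.transpose * B) α) {f : admissible Ω ΓD →L[ℝ] ℝ}
    {u uh v : admissible Ω ΓD} (hu : IsWeakSolution (B.transpose * B) f u)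
    (huh : M.IsESFEMSolution (B.transpose * B) f uh) (hv : v ∈ M.Vh ΓD) {τ : W Ω}
    (hτ : τ ∈ M.W1h) :
    ‖matAct Ω B (M.smoothedStrain (uh : Jet Ω) - M.smoothedStrain (v : Jet Ω))‖
      ≤ ‖matAct Ω B (strain (u : Jet Ω) - M.smoothedStrain (v : Jet Ω))‖
        + 1 / α * ‖matAct Ω B⁻¹.transpose
            (matAct Ω (B.transpose * B) (strain (u : Jet Ω)) - τ)‖ := by
  obtain ⟨hα0, hα⟩ := hα
  have hw : uh - v ∈ M.Vh ΓD := (M.Vh ΓD).sub_mem huh.1 hv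
  have he : M.smoothedStrain (uh : Jet Ω) - M.smoothedStrain (v : Jet Ω)
      = M.smoothedStrain ((uh - v : admissible Ω ΓD) : Jet Ω) :=
    (M.smoothedStrain_sub hΩ _ _).symm
  have hstab := hα _ (Or.inr (M.mem_kernelZh hΩ hw))
  simp only [piNorm, piSeminorm, strainNorm_transpose_mul_self] at hstab
  have e1 := hu (uh - v)
  have e2 := huh.2 _ hw
  have eτ := M.inner_smoothedStrain hΩ hτ ((uh - v : admissible Ω ΓD) : Jet Ω)
  have hproj := M.norm_strain_sub_smoothedStrain_le (B := B) hΩ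
    ((uh - v : admissible Ω ΓD) : Jet Ω)
  rw [← he] at hstab e2 eτ hproj
  generalize strain ((uh - v : admissible Ω ΓD) : Jet Ω) = b at *
  generalize strain (u : Jet Ω) = ε at *
  generalize M.smoothedStrain (uh : Jet Ω) = p at *
  generalize M.smoothedStrain (v : Jet Ω) = q at *
  have hb : ‖matAct Ω B (b - (p - q))‖ ≤ 1 / α * ‖matAct Ω B (p - q)‖ := by
    rw [one_div, le_inv_mul_iff₀ hα0]
    refine le_trans (mul_le_mul_of_nonneg_left (hproj.trans ?_) hα0.le) hstab
    apply Real.le_sqrt_of_sq_le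
    linarith [sq_nonneg ‖matAct Ω B (p - q)‖]
  -- Both solutions give the same `f (uh - v)`, which trades `⟨D p, p - q⟩` for `⟨D ε, b⟩`.
  -- Subtracting `τ` is free, since `p - q` is the projection of `b`.
  have hsq : ‖matAct Ω B (p - q)‖ ^ 2
      = inner ℝ (matAct Ω (B.transpose * B) ε - τ) (b - (p - q))
        + inner ℝ (matAct Ω B (ε - q)) (matAct Ω B (p - q)) := by
    have h1 : inner ℝ (matAct Ω (B.transpose * B) (p - q)) (p - q)
        = ‖matAct Ω B (p - q)‖ ^ 2 := by
      rw [inner_matAct_transpose_mul_self, real_inner_self_eq_norm_sq]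
    rw [← h1, ← inner_matAct_transpose_mul_self, map_sub, map_sub]
    simp only [inner_sub_left] at e2 eτ ⊢
    simp only [inner_sub_right] at e2 eτ ⊢
    linarith
  have hdual := inner_le_norm_mul_norm_of_isUnit_det hB
    (matAct Ω (B.transpose * B) ε - τ) (b - (p - q))
  have hcs := real_inner_le_norm (matAct Ω B (ε - q)) (matAct Ω B (p - q))
  have hdual' := hdual.trans (mul_le_mul_of_nonneg_left hb (norm_nonneg _))
  rcases (norm_nonneg (matAct Ω B (p - q))).eq_or_lt with h0 | hpos
  · rw [← h0]
    positivity
  · refine le_of_mul_le_mul_right ?_ hpos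
    linarith

end Mesh

end ESFEM

end

theorem mainTheorem9 (k : ESFEM.ElementKind) (Ω ΓD : Set ESFEM.Plane)
    (hΩ : ESFEM.IsPolygonalDomain Ω) (hΓ : ΓD ⊆ frontier Ω) (hΓne : ΓD.Nonempty)
    (D : Matrix (Fin 3) (Fin 3) ℝ) (hD : D.PosDef) (M : ESFEM.Mesh k Ω) :
    -- the discrete stability inequality
    (∃ C : ℝ, 0 < C ∧ ∀ v ∈ M.Vh ΓD,
      C * ESFEM.strainNorm D (ESFEM.strain (v : ESFEM.Jet Ω)) ≤
        ESFEM.strainNorm D (M.smoothedStrain (v : ESFEM.Jet Ω))) ∧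
    -- the stability assumption holds
    (∃ α : ℝ, M.IsStabilityConstant ΓD D α) ∧
    -- the error estimate, with `C_B = 2 / α`
    ∀ α : ℝ, M.IsStabilityConstant ΓD D α →
      ∀ (f : ESFEM.admissible Ω ΓD →L[ℝ] ℝ) (u uh : ESFEM.admissible Ω ΓD),
        ESFEM.IsWeakSolution D f u → M.IsESFEMSolution D f uh →
        ESFEM.strainNorm D
            (ESFEM.strain (u : ESFEM.Jet Ω) - M.smoothedStrain (uh : ESFEM.Jet Ω)) ≤
          2 * (⨅ v : M.Vh ΓD, ESFEM.strainNorm D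
            (ESFEM.strain (u : ESFEM.Jet Ω) - M.smoothedStrain (v.1 : ESFEM.Jet Ω))) +
          2 / α * ((⨅ τ₁ : M.W1h, ESFEM.stressNorm D
              (ESFEM.matAct Ω D (ESFEM.strain (u : ESFEM.Jet Ω)) - (τ₁ : ESFEM.W Ω))) +
            ⨅ τ₂ : M.W1h, ESFEM.stressNorm D
              (ESFEM.matAct Ω D (ESFEM.strain (u : ESFEM.Jet Ω)) - (τ₂ : ESFEM.W Ω))) := by
  obtain ⟨B, hB, rfl⟩ := ESFEM.exists_isUnit_det_transpose_mul_self hD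
  simp only [ESFEM.strainNorm_transpose_mul_self, ESFEM.stressNorm_transpose_mul_self]
  refine ⟨M.exists_smoothedStrain_bound hΩ ΓD hB, M.exists_isStabilityConstant hΩ ΓD hB, ?_⟩
  intro α hα f u uh hu huh
  have hα0 : 0 < α := hα.1
  have hbound : ∀ (v : M.Vh ΓD) (τ : M.W1h),
      ‖ESFEM.matAct Ω B (ESFEM.strain (u : ESFEM.Jet Ω) - M.smoothedStrain (uh : ESFEM.Jet Ω))‖ ≤
        2 * ‖ESFEM.matAct Ω B
          (ESFEM.strain (u : ESFEM.Jet Ω) - M.smoothedStrain (v.1 : ESFEM.Jet Ω))‖ +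
        1 / α * ‖ESFEM.matAct Ω B⁻¹.transpose (ESFEM.matAct Ω (B.transpose * B)
          (ESFEM.strain (u : ESFEM.Jet Ω)) - (τ : ESFEM.W Ω))‖ := by
    intro v τ
    have h1 := M.norm_smoothedStrain_sub_le hΩ hB hα hu huh v.2 τ.2
    have h2 := norm_sub_le
      (ESFEM.matAct Ω B (ESFEM.strain (u : ESFEM.Jet Ω) - M.smoothedStrain (v.1 : ESFEM.Jet Ω)))
      (ESFEM.matAct Ω B
        (M.smoothedStrain (uh : ESFEM.Jet Ω) - M.smoothedStrain (v.1 : ESFEM.Jet Ω)))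
    rw [← map_sub, sub_sub_sub_cancel_right] at h2
    linarith
  set X := ‖ESFEM.matAct Ω B
    (ESFEM.strain (u : ESFEM.Jet Ω) - M.smoothedStrain (uh : ESFEM.Jet Ω))‖
  set I := ⨅ v : M.Vh ΓD, ‖ESFEM.matAct Ω B
    (ESFEM.strain (u : ESFEM.Jet Ω) - M.smoothedStrain (v.1 : ESFEM.Jet Ω))‖ with hI
  set J := ⨅ τ : M.W1h, ‖ESFEM.matAct Ω B⁻¹.transpose (ESFEM.matAct Ω (B.transpose * B)
    (ESFEM.strain (u : ESFEM.Jet Ω)) - (τ : ESFEM.W Ω))‖ with hJ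
  have hJ0 : 0 ≤ J := Real.iInf_nonneg fun _ => norm_nonneg _
  -- The infima are taken one at a time: over `v` for fixed `τ`, then over `τ`.
  have hJle : α * (X - 2 * I) ≤ J := by
    refine le_ciInf fun τ => ?_
    have hle : (X - 1 / α * ‖ESFEM.matAct Ω B⁻¹.transpose (ESFEM.matAct Ω (B.transpose * B)
        (ESFEM.strain (u : ESFEM.Jet Ω)) - (τ : ESFEM.W Ω))‖) / 2 ≤ I :=
      le_ciInf fun v => by linarith [hbound v τ]
    rw [← le_inv_mul_iff₀ hα0, ← one_div]
    linarith
  rw [← le_inv_mul_iff₀ hα0] at hJle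
  have hα1 : 0 ≤ α⁻¹ * J := by positivity
  calc X ≤ 2 * I + α⁻¹ * J := by linarith
    -- The stated bound has two equal stress infima with constant `2 / α`, four times what is
    -- needed.
    _ ≤ 2 * I + 4 * (α⁻¹ * J) := by linarith
    _ = 2 * I + 2 / α * (J + J) := by ring
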